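/- Let $\omega=\exp(2\pi i/3)$. A complex Hadamard matrix of order $N$ is an $N\times N$ complex matrix $H$ with all entries of modulus $1$ and $H^\dagger H=NI$; it belongs to the Butson class $BH(N,q)$ if all its entries are $q$-th roots of unity. Two such matrices $H,K$ are equivalent, $H\sim K$, if $H=P_1D_1KD_2P_2$ with permutation matrices $P_1,P_2$ and unitary diagonal matrices $D_1,D_2$. The defect of $H$ is $d(H)=r-(2N-1)$, where $r$ is the dimension of the real vector space of all real $N\times N$ matrices $R$ such that, with $H(t)_{ij}=H_{ij}\exp(itR_{ij})$, one has $\frac{d}{dt}\big(H(t)^\dagger H(t)\big)\big|_{t=0}=0$. The orbit $BC_9^{(2)}$ is the set of all matrices $$BC_9(x,y,u,w)=\begin{pmatrix}A&B&B^T\\B^T&A&B\\B&B^T&A\end{pmatrix},\qquad A=\begin{pmatrix}1&x&x\\x&1&x\\x&x&1\end{pmatrix},\quad B=\begin{pmatrix}y&u&w\\w&y&u\\u&w&y\end{pmatrix},$$ with $|x|=|y|=|u|=|w|=1$ and $x+y+u+w=1$. The Fourier orbit $F_9^{(4)}$ (in block form) is the set of all matrices $$\begin{pmatrix}F_3&\Delta_1F_3&\Delta_2F_3\\F_3&\omega\Delta_1F_3&\omega^2\Delta_2F_3\\F_3&\omega^2\Delta_1F_3&\omega\Delta_2F_3\end{pmatrix},\qquad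 F_3=\begin{pmatrix}1&1&1\\1&\omega&\omega^2\\1&\omega^2&\omega\end{pmatrix},$$ where $\Delta_1=\mathrm{diag}(1,x_1,x_2)$, $\Delta_2=\mathrm{diag}(1,x_3,x_4)$ and $|x_1|=|x_2|=|x_3|=|x_4|=1$. Finally let $$BC_{9Ab}=\begin{pmatrix}C_3&-\omega^2C_3^\dagger&-\omega^2C_3^\dagger\\-\omega^2C_3^\dagger&C_3&-\omega^2C_3^\dagger\\-\omega^2C_3^\dagger&-\omega^2C_3^\dagger&C_3\end{pmatrix},\qquad C_3=\begin{pmatrix}1&\omega&\omega\\\omega&1&\omega\\\omega&\omega&1\end{pmatrix}.$$ Proposition. The matrices $BC_{9Ab}$ and $BC_{9Ab}^\dagger$ both belong to $BH(9,6)$, both lie on the orbit $BC_9^{(2)}$, and both have defect $10$. They are not equivalent to each other. Neither of them is an element of the Fourier orbit $F_9^{(4)}$, even up to equivalence: neither is equivalent to any matrix in $F_9^{(4)}$. Moreover, exactly $6^4$ matrices of $F_9^{(4)}$ (in the above block form) belong to $BH(9,6)$, and none of these has defect $10$. -/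

import Mathlib

open scoped Matrix

noncomputable section

namespace BCCB

/-- The cube root of unity `ω = exp(2πi/3)`. -/
def omega : ℂ := Complex.exp (2 * Real.pi * Complex.I / 3)

/-- Complex Hadamard matrices: all entries of modulus `1`, and `Hᴴ H = N I`. -/
def IsHadamard {n : Type*} [Fintype n] [DecidableEq n] (H : Matrix n n ℂ) : Prop :=
  (∀ i j, ‖H i j‖ = 1) ∧ Hᴴ * H = (Fintype.card n : ℂ) • (1 : Matrix n n ℂ)

/-- The Butson class `BH(N, q)`, where `N` is the number of elements of `n`: complex Hadamard
matrices all of whose entries are `q`-th roots of unity. -/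
def IsButson {n : Type*} [Fintype n] [DecidableEq n] (q : ℕ) (H : Matrix n n ℂ) : Prop :=
  IsHadamard H ∧ ∀ i j, H i j ^ q = 1

/-- Equivalence of complex Hadamard matrices: `H = P₁ D₁ K D₂ P₂` with permutation matrices
`P₁, P₂` and unitary diagonal matrices `D₁, D₂`. -/
def Equivalent {n : Type*} [Fintype n] [DecidableEq n] (H K : Matrix n n ℂ) : Prop :=
  ∃ (σ τ : Equiv.Perm n) (d e : n → ℂ), (∀ i, ‖d i‖ = 1) ∧ (∀ i, ‖e i‖ = 1) ∧
    H = σ.permMatrix ℂ * Matrix.diagonal d * K * Matrix.diagonal e * τ.permMatrix ℂ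

/-- The real vector space of all real matrices `R` of phase velocities along which the unitarity
constraint is preserved to first order: with `H(t)_{ij} = H_{ij} exp(i t R_{ij})`, the derivative
of `H(t)ᴴ H(t)` at `t = 0` vanishes. That derivative is written out explicitly here, see
`mem_phaseSpace_iff`. -/
def phaseSpace {n : Type*} [Fintype n] (H : Matrix n n ℂ) : Submodule ℝ (Matrix n n ℝ) where
  carrier := {R | ∀ j k, ∑ i, star (H i j) * H i k * ((R i k : ℂ) - (R i j : ℂ)) = 0}
  zero_mem' := by intro j k; simp
  add_mem' := by
    intro R S hR hS j k
    have h := congrArg₂ (· + ·) (hR j k) (hS j k)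
    simp only [← Finset.sum_add_distrib, add_zero] at h
    rw [← h]
    refine Finset.sum_congr rfl fun i _ => ?_
    simp only [Matrix.add_apply, Complex.ofReal_add]
    ring
  smul_mem' := by
    intro c R hR j k
    have h := congrArg ((c : ℂ) * ·) (hR j k)
    simp only [Finset.mul_sum, mul_zero] at h
    rw [← h]
    refine Finset.sum_congr rfl fun i _ => ?_
    simp only [Matrix.smul_apply, smul_eq_mul, Complex.ofReal_mul]
    ring

theorem mem_phaseSpace_iff {n : Type*} [Fintype n] (H : Matrix n n ℂ) (R : Matrix n n ℝ) :
    R ∈ phaseSpace H ↔ ∀ j k, HasDerivAt (fun t : ℝ =>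
      ((Matrix.of fun i j => H i j * Complex.exp (Complex.I * t * R i j))ᴴ *
        (Matrix.of fun i j => H i j * Complex.exp (Complex.I * t * R i j))) j k) 0 0 := by
  have key : ∀ j k, HasDerivAt (fun t : ℝ =>
      ((Matrix.of fun i j => H i j * Complex.exp (Complex.I * t * R i j))ᴴ *
        (Matrix.of fun i j => H i j * Complex.exp (Complex.I * t * R i j))) j k)
      (Complex.I * ∑ i, star (H i j) * H i k * ((R i k : ℂ) - (R i j : ℂ))) 0 := by
    intro j k
    have hfun : (fun t : ℝ =>
      ((Matrix.of fun i j => H i j * Complex.exp (Complex.I * t * R i j))ᴴ *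
        (Matrix.of fun i j => H i j * Complex.exp (Complex.I * t * R i j))) j k) =
        fun t : ℝ => ∑ i, star (H i j) * H i k *
          Complex.exp ((t : ℂ) * (Complex.I * ((R i k : ℂ) - (R i j : ℂ)))) := by
      funext t
      simp only [Matrix.mul_apply, Matrix.conjTranspose_apply, Matrix.of_apply, star_mul',
        Complex.star_def, ← Complex.exp_conj, map_mul, Complex.conj_I, Complex.conj_ofReal]
      refine Finset.sum_congr rfl fun i _ => ?_
      rw [mul_mul_mul_comm, ← Complex.exp_add]
      congr 2
      ring
    rw [hfun, Finset.mul_sum]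
    refine HasDerivAt.fun_sum fun i _ => ?_
    have h1 : HasDerivAt (fun t : ℝ => (t : ℂ) * (Complex.I * ((R i k : ℂ) - (R i j : ℂ))))
        (1 * (Complex.I * ((R i k : ℂ) - (R i j : ℂ)))) 0 :=
      (Complex.ofRealCLM.hasDerivAt (x := 0)).mul_const _
    have h2 := (h1.cexp).const_mul (star (H i j) * H i k)
    refine h2.congr_deriv ?_
    simp only [Complex.ofReal_zero, zero_mul, Complex.exp_zero]
    ring
  constructor
  · intro h j k
    have := key j k
    rwa [h j k, mul_zero] at this
  · intro h j k
    have := (key j k).unique (h j k)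
    simpa using this

/-- The defect `d(H) = r - (2N - 1)`, where `r` is the dimension of the solution space of the
linearized unitarity constraint. -/
def defect {n : Type*} [Fintype n] (H : Matrix n n ℂ) : ℤ :=
  (Module.finrank ℝ (phaseSpace H) : ℤ) - (2 * (Fintype.card n : ℤ) - 1)

/-- The `9 × 9` matrix assembled from a `3 × 3` array of `3 × 3` blocks; rows and columns are
indexed by (block, position inside the block). -/
def ofBlocks (M : Matrix (Fin 3) (Fin 3) (Matrix (Fin 3) (Fin 3) ℂ)) :
    Matrix (Fin 3 × Fin 3) (Fin 3 × Fin 3) ℂ :=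
  Matrix.of fun p q => M p.1 q.1 p.2 q.2

/-- The diagonal block of the symmetric block circulant matrix with circulant blocks. -/
def blockA (x : ℂ) : Matrix (Fin 3) (Fin 3) ℂ := !![1, x, x; x, 1, x; x, x, 1]

/-- The off-diagonal block of the symmetric block circulant matrix with circulant blocks. -/
def blockB (y u w : ℂ) : Matrix (Fin 3) (Fin 3) ℂ := !![y, u, w; w, y, u; u, w, y]

/-- The symmetric block circulant matrix with circulant blocks `BC₉(x, y, u, w)`. -/
def BC9 (x y u w : ℂ) : Matrix (Fin 3 × Fin 3) (Fin 3 × Fin 3) ℂ :=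
  ofBlocks !![blockA x, blockB y u w, (blockB y u w)ᵀ;
              (blockB y u w)ᵀ, blockA x, blockB y u w;
              blockB y u w, (blockB y u w)ᵀ, blockA x]

/-- The two-parameter orbit `BC₉⁽²⁾`: all matrices `BC₉(x, y, u, w)` with unimodular `x, y, u, w`
such that `x + y + u + w = 1`. -/
def BC9Orbit : Set (Matrix (Fin 3 × Fin 3) (Fin 3 × Fin 3) ℂ) :=
  {H | ∃ x y u w : ℂ, ‖x‖ = 1 ∧ ‖y‖ = 1 ∧ ‖u‖ = 1 ∧ ‖w‖ = 1 ∧ x + y + u + w = 1 ∧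
    H = BC9 x y u w}

/-- The circulant Hadamard matrix `C₃`. -/
def C3 : Matrix (Fin 3) (Fin 3) ℂ := !![1, omega, omega; omega, 1, omega; omega, omega, 1]

/-- The matrix `BC_{9Ab}`. -/
def BC9Ab : Matrix (Fin 3 × Fin 3) (Fin 3 × Fin 3) ℂ :=
  ofBlocks !![C3, (-omega ^ 2) • C3ᴴ, (-omega ^ 2) • C3ᴴ;
              (-omega ^ 2) • C3ᴴ, C3, (-omega ^ 2) • C3ᴴ;
              (-omega ^ 2) • C3ᴴ, (-omega ^ 2) • C3ᴴ, C3]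

/-- The Fourier matrix `F₃`. -/
def F3 : Matrix (Fin 3) (Fin 3) ℂ :=
  !![1, 1, 1; 1, omega, omega ^ 2; 1, omega ^ 2, omega]

/-- The member of the Fourier family of order 9 with phase parameters `x₁, x₂, x₃, x₄`,
with `Δ₁ = diag(1, x₁, x₂)` and `Δ₂ = diag(1, x₃, x₄)`. -/
def F9 (x₁ x₂ x₃ x₄ : ℂ) : Matrix (Fin 3 × Fin 3) (Fin 3 × Fin 3) ℂ :=
  let Δ₁ : Matrix (Fin 3) (Fin 3) ℂ := Matrix.diagonal ![1, x₁, x₂]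
  let Δ₂ : Matrix (Fin 3) (Fin 3) ℂ := Matrix.diagonal ![1, x₃, x₄]
  ofBlocks !![F3, Δ₁ * F3, Δ₂ * F3;
              F3, omega • (Δ₁ * F3), omega ^ 2 • (Δ₂ * F3);
              F3, omega ^ 2 • (Δ₁ * F3), omega • (Δ₂ * F3)]

/-- The four-parameter Fourier orbit `F₉⁽⁴⁾`, in its block form. -/
def F9Orbit : Set (Matrix (Fin 3 × Fin 3) (Fin 3 × Fin 3) ℂ) :=
  {H | ∃ x₁ x₂ x₃ x₄ : ℂ, ‖x₁‖ = 1 ∧ ‖x₂‖ = 1 ∧ ‖x₃‖ = 1 ∧ ‖x₄‖ = 1 ∧ H = F9 x₁ x₂ x₃ x₄}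

end BCCB

end

open scoped Matrix

noncomputable section

namespace BCCB

/-! All entries of `BC9Ab` are powers of `zeta`, and `1, ω` are linearly independent over `ℝ`.
Orthogonality and the linearized unitarity constraint therefore become statements about integers.
The constraint is a system of 72 integer equations in 81 phases; its rank 54 is computed by a
verified elimination (`lrank_add_finrank_sol`), so `r = 27` and the defect is `27 - 17 = 10`. As
`BC9Ab` is symmetric, its adjoint is its complex conjugate, and conjugating the equations does not
change their real solutions.

Inequivalence is shown by monomial relations between entries in which all row and column factors
cancel. `HasParallelTriples` holds throughout the Fourier orbit, because in the rows `(0,i), (1,i),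
(2,i)` the columns of one block column are proportional; it fails for `BC9Ab` and its adjoint.
`IsPositive` mentions `ω` itself, so complex conjugation need not preserve it; it holds for `BC9Ab`
and fails for the adjoint.

For a member of the Fourier orbit, a Fourier transform of the phases over block rows and positions
inside blocks decouples the constraint into 3-cycles along the 12 lines of the affine plane over
`ℤ/3`. A cycle contributes one complex dimension if the product of its factors (the holonomy) is
`1`, and nothing otherwise. Hence `r = 9 + 2L`, with `L` the number of lines of trivial holonomy,
and the defect is `2L - 8`. The six axis-parallel lines are always trivial. Each other line is
trivial exactly when `X = p ^ 3`, where `X = x₁x₂x₃x₄` and `p` is the product of the phases on the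
line. For sixth roots of unity the six numbers `p ^ 3` are signs with product `X ^ 6 = 1`, so an
even number of them equals `X`. Thus `L` is even, whereas defect `10` would need `L = 9`. -/

/-! ### Rank of integer linear systems by fraction-free elimination. -/

/-- The linear form on `ℝⁿ` with the given list of coefficients. -/
def dot {n : ℕ} (r : List ℤ) (x : Fin n → ℝ) : ℝ := ∑ i : Fin n, (r.getD i 0 : ℝ) * x i

/-- The solution space of a homogeneous linear system with integer coefficients. -/
def sol (n : ℕ) (rows : List (List ℤ)) : Submodule ℝ (Fin n → ℝ) where
  carrier := {x | ∀ r ∈ rows, dot r x = 0}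
  zero_mem' := by intro r _; simp [dot]
  add_mem' := by
    intro x y hx hy r hr
    have h := congrArg₂ (· + ·) (hx r hr) (hy r hr)
    simpa [dot, mul_add, Finset.sum_add_distrib] using h
  smul_mem' := by
    intro c x hx r hr
    have h := congrArg (c * ·) (hx r hr)
    simpa [dot, Finset.mul_sum, mul_left_comm] using h

theorem mem_sol {n : ℕ} {rows : List (List ℤ)} {x : Fin n → ℝ} :
    x ∈ sol n rows ↔ ∀ r ∈ rows, dot r x = 0 := Iff.rfl

theorem getD_tail (r : List ℤ) (i : ℕ) : r.tail.getD i 0 = r.getD (i + 1) 0 := by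
  cases r <;> simp

theorem getD_zero_eq (r : List ℤ) : r.getD 0 0 = r.headD 0 := by
  cases r <;> simp

theorem dot_succ {n : ℕ} (r : List ℤ) (x : Fin (n + 1) → ℝ) :
    dot r x = (r.headD 0 : ℝ) * x 0 + dot r.tail (Fin.tail x) := by
  simp only [dot, Fin.sum_univ_succ, getD_tail, Fin.tail, Fin.val_succ, Fin.val_zero, getD_zero_eq]

/-- Test whether an integer is nonzero. -/
def nz : ℤ → Bool
  | .ofNat 0 => false
  | _ => true

theorem nz_eq_false {a : ℤ} : nz a = false ↔ a = 0 := by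
  match a with
  | .ofNat 0 => exact iff_of_true rfl rfl
  | .ofNat (n + 1) => simp only [nz, reduceCtorEq, false_iff]; simp only [Int.ofNat_eq_natCast]; omega
  | .negSucc n => simp [nz]

/-- Test whether an integer is `1` or `-1`. -/
def isSign : ℤ → Bool
  | .ofNat 1 => true
  | .negSucc 0 => true
  | _ => false

theorem ne_zero_of_isSign {a : ℤ} (h : isSign a = true) : a ≠ 0 := by
  rintro rfl
  exact absurd h (by decide)

/-- The entrywise difference of two coefficient lists. -/
def subl : List ℤ → List ℤ → List ℤ
  | [], r => r.map Neg.neg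
  | s, [] => s
  | x :: s, y :: r => (x - y) :: subl s r

/-- The entrywise sum of two coefficient lists. -/
def addl : List ℤ → List ℤ → List ℤ
  | [], r => r
  | s, [] => s
  | x :: s, y :: r => (x + y) :: addl s r

/-- The combination `a s - b r` of two coefficient lists. -/
def combine (a b : ℤ) : List ℤ → List ℤ → List ℤ
  | [], r => r.map fun y => -(b * y)
  | x :: s, [] => (a * x) :: combine a b s []
  | x :: s, y :: r => (a * x - b * y) :: combine a b s r

theorem getD_subl (s r : List ℤ) (i : ℕ) :
    (subl s r).getD i 0 = s.getD i 0 - r.getD i 0 := by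
  induction s generalizing r i with
  | nil =>
    -- `List.getD_map` requires a default value that is itself an image under the map, so `0` is
    -- written as `-0`.
    rw [subl, List.getD_nil, zero_sub, ← neg_zero, List.getD_map, neg_zero]
  | cons x s ih => cases r <;> cases i <;> simp_all [subl]

theorem getD_addl (s r : List ℤ) (i : ℕ) :
    (addl s r).getD i 0 = s.getD i 0 + r.getD i 0 := by
  induction s generalizing r i with
  | nil => simp [addl]
  | cons x s ih => cases r <;> cases i <;> simp_all [addl]

theorem getD_combine (a b : ℤ) (s r : List ℤ) (i : ℕ) :
    (combine a b s r).getD i 0 = a * s.getD i 0 - b * r.getD i 0 := by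
  induction s generalizing r i with
  | nil =>
    have h := List.getD_map (l := r) (d := 0) (n := i) fun y : ℤ => -(b * y)
    rw [mul_zero, neg_zero] at h
    rw [combine, h, List.getD_nil, mul_zero, zero_sub]
  | cons x s ih => cases r <;> cases i <;> simp_all [combine]

/-- Eliminate the first variable from `s`, using the equation with leading coefficient `a` and
remaining coefficients `r`. -/
def elim (a : ℤ) (r s : List ℤ) : List ℤ :=
  match s with
  | [] => []
  | b :: s' => match nz b with
    | false => s'
    | true => match nz (b - a) with
      | false => subl s' r
      | true => match nz (b + a) with
        | false => addl s' r
        | true => combine a b s' r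

/-- All branches of `elim` are cases of `u • s - v • (a :: r)` with vanishing leading coefficient.
Since `u ≠ 0`, no solution is gained or lost; the pairs `(1, 0)`, `(1, 1)`, `(1, -1)` avoid
multiplying the coefficients. -/
theorem exists_elim_eq {a : ℤ} (ha : a ≠ 0) (r s : List ℤ) :
    ∃ u v : ℤ, u ≠ 0 ∧ u * s.headD 0 = v * a ∧
      ∀ i, (elim a r s).getD i 0 = u * s.tail.getD i 0 - v * r.getD i 0 := by
  cases s with
  | nil => exact ⟨1, 0, by simp, by simp, fun i => by simp [elim]⟩
  | cons b s =>
    cases h1 : nz b with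
    | false =>
      exact ⟨1, 0, by simp, by simp [nz_eq_false.1 h1], fun i => by simp [elim, h1]⟩
    | true =>
      cases h2 : nz (b - a) with
      | false =>
        have h3 := nz_eq_false.1 h2
        refine ⟨1, 1, by simp, ?_, fun i => by simp [-List.getD_eq_getElem?_getD, elim, h1, h2, getD_subl]⟩
        simp only [List.headD_cons]; linarith
      | true =>
        cases h3 : nz (b + a) with
        | false =>
          have h4 := nz_eq_false.1 h3
          refine ⟨1, -1, by simp, ?_, fun i => by simp [-List.getD_eq_getElem?_getD, elim, h1, h2, h3, getD_addl]⟩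
          simp only [List.headD_cons]; linarith
        | true =>
          exact ⟨a, b, ha, by simp [mul_comm], fun i => by
            simp [-List.getD_eq_getElem?_getD, elim, h1, h2, h3, getD_combine]⟩

/-- An equation in which the first variable occurs, preferably with coefficient `1` or `-1`. -/
def pivot (rows : List (List ℤ)) : Option (List ℤ) :=
  match rows.find? fun r => isSign (r.headD 0) with
  | some r => some r
  | none => rows.find? fun r => nz (r.headD 0)

theorem pivot_eq_some {rows : List (List ℤ)} {r : List ℤ} (h : pivot rows = some r) :
    r ∈ rows ∧ r.headD 0 ≠ 0 := by
  unfold pivot at h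
  split at h
  · next s hs =>
    cases h
    exact ⟨List.mem_of_find?_eq_some hs, ne_zero_of_isSign (List.find?_some (p := fun r : List ℤ => isSign (r.headD 0)) hs)⟩
  · refine ⟨List.mem_of_find?_eq_some h, fun h0 => ?_⟩
    have := List.find?_some (p := fun r : List ℤ => nz (r.headD 0)) h
    rw [h0] at this
    exact absurd this (by decide)

theorem pivot_eq_none {rows : List (List ℤ)} (h : pivot rows = none) :
    ∀ r ∈ rows, r.headD 0 = 0 := by
  unfold pivot at h
  split at h
  · cases h
  · intro r hr
    have := List.find?_eq_none.1 h r hr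
    exact nz_eq_false.1 (by simpa using this)

/-- The rank of a linear system with integer coefficients in `n` variables, by elimination. -/
def lrank : ℕ → List (List ℤ) → ℕ
  | 0, _ => 0
  | n + 1, rows => match pivot rows with
    | none => lrank n (rows.map List.tail)
    | some r => (lrank n ((rows.map (elim (r.headD 0) r.tail)).filter fun s => s.any nz)).succ

theorem dot_eq_zero_of_any_nz {n : ℕ} {s : List ℤ} (h : s.any nz = false) (x : Fin n → ℝ) :
    dot s x = 0 := by
  refine Finset.sum_eq_zero fun i _ => ?_
  have : s.getD i 0 = 0 := by
    rw [List.any_eq_false] at h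
    by_cases hi : (i : ℕ) < s.length
    · rw [List.getD_eq_getElem _ _ hi]
      exact nz_eq_false.1 (by simpa using h _ (List.getElem_mem hi))
    · exact List.getD_eq_default _ _ (not_lt.1 hi)
  rw [this, Int.cast_zero, zero_mul]

/-- The first variable occurs in no equation, so it is free and splits off a factor `ℝ`. -/
theorem finrank_sol_of_pivot_none {n : ℕ} {rows : List (List ℤ)} (h : pivot rows = none) :
    Module.finrank ℝ (sol (n + 1) rows) =
      Module.finrank ℝ (sol n (rows.map List.tail)) + 1 := by
  have h0 := pivot_eq_none h
  have key : ∀ x : Fin (n + 1) → ℝ, x ∈ sol (n + 1) rows ↔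
      Fin.tail x ∈ sol n (rows.map List.tail) := by
    intro x
    simp only [mem_sol, List.mem_map, forall_exists_index, and_imp, forall_apply_eq_imp_iff₂]
    refine forall₂_congr fun r hr => ?_
    rw [dot_succ, h0 r hr]
    simp
  let e : sol (n + 1) rows ≃ₗ[ℝ] sol n (rows.map List.tail) × ℝ :=
    { toFun := fun x => (⟨Fin.tail x.1, (key _).1 x.2⟩, x.1 0)
      map_add' := fun _ _ => rfl
      map_smul' := fun _ _ => rfl
      invFun := fun y => ⟨Fin.cons y.2 y.1.1, (key _).2 (by simp)⟩
      left_inv := fun x => Subtype.ext (Fin.cons_self_tail x.1)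
      right_inv := fun y => Prod.ext (Subtype.ext (by simp)) (by simp) }
  rw [e.finrank_eq, Module.finrank_prod, Module.finrank_self]

/-- The pivot equation determines the first variable from the others, so forgetting it is an
isomorphism onto the solutions of the eliminated system. Discarding zero rows loses no condition. -/
theorem finrank_sol_of_pivot_some {n : ℕ} {rows : List (List ℤ)} {r : List ℤ}
    (h : pivot rows = some r) :
    Module.finrank ℝ (sol (n + 1) rows) = Module.finrank ℝ
      (sol n ((rows.map (elim (r.headD 0) r.tail)).filter fun s => s.any nz)) := by
  obtain ⟨hr, ha⟩ := pivot_eq_some h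
  have haR : (r.headD 0 : ℝ) ≠ 0 := by exact_mod_cast ha
  have key : ∀ y : Fin n → ℝ,
      y ∈ sol n ((rows.map (elim (r.headD 0) r.tail)).filter fun s => s.any nz) ↔
      ∀ s ∈ rows, dot (elim (r.headD 0) r.tail s) y = 0 := by
    intro y
    simp only [mem_sol, List.mem_filter, List.mem_map, and_imp, forall_exists_index,
      forall_apply_eq_imp_iff₂]
    refine forall₂_congr fun s _ => ⟨fun h => ?_, fun h _ => h⟩
    cases h1 : (elim (r.headD 0) r.tail s).any nz with
    | false => exact dot_eq_zero_of_any_nz h1 y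
    | true => exact h h1
  have key2 : ∀ x : Fin (n + 1) → ℝ, dot r x = 0 → ∀ s,
      (dot (elim (r.headD 0) r.tail s) (Fin.tail x) = 0 ↔ dot s x = 0) := by
    intro x hx s
    obtain ⟨u, v, hu, huv, he⟩ := exists_elim_eq ha r.tail s
    have e1 : dot (elim (r.headD 0) r.tail s) (Fin.tail x) =
        u * dot s.tail (Fin.tail x) - v * dot r.tail (Fin.tail x) := by
      simp only [dot, he, Finset.mul_sum, ← Finset.sum_sub_distrib]
      refine Finset.sum_congr rfl fun i _ => ?_
      push_cast; ring
    rw [dot_succ] at hx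
    have huvR : (u : ℝ) * s.headD 0 = v * r.headD 0 := by exact_mod_cast huv
    have e2 : dot (elim (r.headD 0) r.tail s) (Fin.tail x) = u * dot s x := by
      rw [e1, dot_succ s]
      linear_combination (-(v : ℝ)) * hx - x 0 * huvR
    rw [e2, mul_eq_zero, or_iff_right (by exact_mod_cast hu)]
  let e : sol (n + 1) rows ≃ₗ[ℝ]
      sol n ((rows.map (elim (r.headD 0) r.tail)).filter fun s => s.any nz) :=
    { toFun := fun x => ⟨Fin.tail x.1, (key _).2 fun s hs =>
        (key2 _ (x.2 r hr) s).2 (x.2 s hs)⟩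
      map_add' := fun _ _ => rfl
      map_smul' := fun _ _ => rfl
      invFun := fun y =>
        ⟨(Fin.cons (-dot r.tail y.1 / r.headD 0) y.1 : Fin (n + 1) → ℝ), by
          have h1 : dot r (Fin.cons (-dot r.tail y.1 / r.headD 0) y.1 : Fin (n + 1) → ℝ) = 0 := by
            rw [dot_succ, Fin.cons_zero, Fin.tail_cons]
            field_simp
            ring
          intro s hs
          rw [← key2 _ h1, Fin.tail_cons]
          exact (key _).1 y.2 s hs⟩
      left_inv := fun x => Subtype.ext (by
        have h1 := x.2 r hr
        rw [dot_succ] at h1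
        have h2 : -dot r.tail (Fin.tail x.1) / r.headD 0 = x.1 0 := by
          field_simp
          linarith
        change Fin.cons (-dot r.tail (Fin.tail x.1) / r.headD 0) (Fin.tail x.1) = x.1
        rw [h2, Fin.cons_self_tail])
      right_inv := fun y => Subtype.ext (Fin.tail_cons (α := fun _ => ℝ) (-dot r.tail y.1 / r.headD 0) y.1) }
  exact e.finrank_eq

theorem lrank_add_finrank_sol (n : ℕ) (rows : List (List ℤ)) :
    lrank n rows + Module.finrank ℝ (sol n rows) = n := by
  induction n generalizing rows with
  | zero =>
    simp only [lrank, zero_add]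
    exact Module.finrank_zero_of_subsingleton
  | succ n ih =>
    unfold lrank
    split
    · next h => rw [finrank_sol_of_pivot_none h, ← add_assoc, ih]
    · next r h =>
      have := ih ((rows.map (elim (r.headD 0) r.tail)).filter fun s => s.any nz)
      rw [finrank_sol_of_pivot_some h]
      omega

/-! ### Cube and sixth roots of unity in the real basis `1, ω`. -/

theorem isPrimitiveRoot_omega : IsPrimitiveRoot omega 3 := by
  have h := Complex.isPrimitiveRoot_exp 3 (by norm_num)
  simpa [omega] using h

theorem omega_pow_three : omega ^ 3 = 1 := isPrimitiveRoot_omega.pow_eq_one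

theorem omega_sq : omega ^ 2 = -1 - omega := by
  have h := isPrimitiveRoot_omega.geom_sum_eq_zero (by norm_num)
  simp only [Finset.sum_range_succ, Finset.sum_range_zero, pow_zero, pow_one] at h
  linear_combination h

theorem norm_omega : ‖omega‖ = 1 :=
  Complex.norm_eq_one_of_pow_eq_one omega_pow_three (by norm_num)

theorem star_eq_inv {z : ℂ} (h : ‖z‖ = 1) : star z = z⁻¹ :=
  (Complex.inv_eq_conj h).symm

theorem star_omega : star omega = omega ^ 2 := by
  rw [star_eq_inv norm_omega]
  exact inv_eq_of_mul_eq_one_right (by rw [← pow_succ', omega_pow_three])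

theorem omega_im_ne_zero : omega.im ≠ 0 := by
  intro h
  have h1 := congrArg Complex.im star_omega
  have h2 := congrArg Complex.re omega_sq
  simp only [pow_two, Complex.mul_re, h, Complex.sub_re, Complex.neg_re, Complex.one_re] at h2
  -- `t ^ 2 + t + 1` has no real root, by completing the square.
  nlinarith [sq_nonneg (omega.re + 1 / 2)]

theorem add_mul_omega_eq_zero {a b : ℝ} : (a : ℂ) + b * omega = 0 ↔ a = 0 ∧ b = 0 := by
  constructor
  · intro h
    have h1 := congrArg Complex.im h
    have hb : b = 0 := by simpa [omega_im_ne_zero] using h1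
    have h2 := congrArg Complex.re h
    exact ⟨by simpa [hb] using h2, hb⟩
  · rintro ⟨rfl, rfl⟩
    simp

/-- The primitive sixth root of unity `-ω² = exp(πi/3)`. -/
def zeta : ℂ := -omega ^ 2

theorem zeta_pow_two : zeta ^ 2 = omega := by
  rw [zeta]; linear_combination omega * omega_pow_three

theorem zeta_pow_three : zeta ^ 3 = -1 := by
  rw [zeta]; linear_combination (-omega ^ 3 - 1) * omega_pow_three

theorem zeta_pow_six : zeta ^ 6 = 1 := by
  linear_combination (zeta ^ 3 - 1) * zeta_pow_three

theorem norm_zeta : ‖zeta‖ = 1 := Complex.norm_eq_one_of_pow_eq_one zeta_pow_six (by norm_num)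

theorem norm_zeta_pow (n : ℕ) : ‖zeta ^ n‖ = 1 := by rw [norm_pow, norm_zeta, one_pow]

theorem star_zeta_pow (n : ℕ) : star (zeta ^ n) = zeta ^ (5 * n) := by
  have h : star zeta = zeta ^ 5 := by
    rw [star_eq_inv norm_zeta, inv_eq_of_mul_eq_one_right]
    rw [← pow_succ', zeta_pow_six]
  rw [star_pow, h, pow_mul]

/-- The first coordinate of `zeta ^ k` with respect to the basis `1, ω`. -/
def coordOne : ℕ → ℤ
  | 0 => 1
  | 1 => 1
  | 2 => 0
  | 3 => -1
  | 4 => -1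
  | _ => 0

/-- The second coordinate of `zeta ^ k` with respect to the basis `1, ω`. -/
def coordOmega : ℕ → ℤ
  | 0 => 0
  | 1 => 1
  | 2 => 1
  | 3 => 0
  | 4 => -1
  | _ => -1

theorem zeta_pow_eq (n : ℕ) :
    zeta ^ n = (coordOne (n % 6) : ℂ) + coordOmega (n % 6) * omega := by
  rw [← Nat.mod_add_div n 6, pow_add, pow_mul, zeta_pow_six, one_pow, mul_one]
  have h1 : zeta = 1 + omega := by rw [zeta, omega_sq]; ring
  have h : n % 6 < 6 := Nat.mod_lt _ (by norm_num)
  rw [Nat.add_mul_mod_self_left, Nat.mod_mod]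
  interval_cases n % 6
  · simp [coordOne, coordOmega]
  · simp [coordOne, coordOmega, h1]
  · simp [coordOne, coordOmega, zeta_pow_two]
  · simp [coordOne, coordOmega, zeta_pow_three]
  · simp only [coordOne, coordOmega]
    push_cast
    linear_combination zeta * zeta_pow_three - h1
  · simp only [coordOne, coordOmega]
    push_cast
    linear_combination zeta ^ 2 * zeta_pow_three - zeta_pow_two

theorem zeta_pow_inj {m n : ℕ} : zeta ^ m = zeta ^ n ↔ m % 6 = n % 6 := by
  constructor
  · intro h
    rw [zeta_pow_eq, zeta_pow_eq, ← sub_eq_zero] at h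
    have h' : (((coordOne (m % 6) - coordOne (n % 6) : ℤ) : ℝ) : ℂ) +
        ((coordOmega (m % 6) - coordOmega (n % 6) : ℤ) : ℝ) * omega = 0 := by
      push_cast
      linear_combination h
    rw [add_mul_omega_eq_zero, Int.cast_eq_zero, Int.cast_eq_zero] at h'
    have hm : m % 6 < 6 := Nat.mod_lt _ (by norm_num)
    have hn : n % 6 < 6 := Nat.mod_lt _ (by norm_num)
    have key : ∀ a < 6, ∀ b < 6, coordOne a - coordOne b = 0 ∧ coordOmega a - coordOmega b = 0 →
      a = b := by decide
    exact key _ hm _ hn h'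
  · intro h
    rw [zeta_pow_eq, h, ← zeta_pow_eq]

/-! ### `BC9Ab` as a table of exponents, and its place on the orbit. -/

/-- The numbering `(a, i) ↦ 3 a + i` of rows and columns. -/
def idx : Fin 3 × Fin 3 ≃ Fin 9 := finProdFinEquiv

theorem idx_apply_val (p : Fin 3 × Fin 3) : (idx p : ℕ) = p.2 + 3 * p.1 := rfl

/-- The matrix of sixth roots of unity with the given table of exponents. -/
def rootMatrix (E : ℕ → ℕ → ℕ) : Matrix (Fin 3 × Fin 3) (Fin 3 × Fin 3) ℂ :=
  Matrix.of fun p q => zeta ^ E (idx p) (idx q)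

theorem rootMatrix_apply (E : ℕ → ℕ → ℕ) (p q : Fin 3 × Fin 3) :
    rootMatrix E p q = zeta ^ E (idx p) (idx q) := rfl

/-- The exponents of the entries of `BC9Ab`. -/
def expo (p q : ℕ) : ℕ :=
  if p = q then 0 else if p / 3 = q / 3 then 2 else if p % 3 = q % 3 then 1 else 5

theorem C3_apply (i j : Fin 3) : C3 i j = if i = j then 1 else omega := by
  fin_cases i <;> fin_cases j <;> rfl

theorem BC9Ab_apply (a b i j : Fin 3) :
    BC9Ab (a, i) (b, j) = if a = b then C3 i j else -omega ^ 2 * star (C3 j i) := by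
  fin_cases a <;> fin_cases b <;> rfl

theorem BC9Ab_eq : BC9Ab = rootMatrix expo := by
  have h5 : zeta ^ 5 = -omega := by
    linear_combination zeta ^ 2 * zeta_pow_three - zeta_pow_two
  have h4 : -omega ^ 2 * star omega = -omega := by
    rw [star_omega]; linear_combination (-omega) * omega_pow_three
  ext ⟨a, i⟩ ⟨b, j⟩
  have hi := i.isLt
  have hj := j.isLt
  have e1 : ((i : ℕ) + 3 * a = j + 3 * b) ↔ a = b ∧ i = j := by omega
  have e2 : ((i : ℕ) + 3 * a) / 3 = (j + 3 * b) / 3 ↔ a = b := by omega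
  have e3 : ((i : ℕ) + 3 * a) % 3 = (j + 3 * b) % 3 ↔ i = j := by omega
  rw [rootMatrix_apply, BC9Ab_apply, C3_apply, C3_apply, expo]
  simp only [idx_apply_val, e1, e2, e3, @eq_comm _ j i]
  by_cases hab : a = b <;> by_cases hij : i = j
  · simp [hab, hij]
  · simp [hab, hij, zeta_pow_two]
  · simp [hab, hij, zeta]
  · simp only [hab, hij, if_false, false_and, h4, h5]

theorem expo_comm (p q : ℕ) : expo p q = expo q p := by
  simp only [expo, eq_comm]

theorem BC9Ab_conjTranspose_eq : BC9Abᴴ = rootMatrix fun p q => 5 * expo p q := by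
  ext p q
  rw [BC9Ab_eq, Matrix.conjTranspose_apply, rootMatrix_apply, rootMatrix_apply, star_zeta_pow,
    expo_comm]

theorem smul_C3_conjTranspose :
    (-omega ^ 2) • C3ᴴ = blockB (-omega ^ 2) (-omega) (-omega) := by
  have h4 : -omega ^ 2 * star omega = -omega := by
    rw [star_omega]; linear_combination (-omega) * omega_pow_three
  ext i j
  rw [Matrix.smul_apply, Matrix.conjTranspose_apply, C3_apply, smul_eq_mul, apply_ite star, mul_ite,
    star_one, mul_one, h4]
  fin_cases i <;> fin_cases j <;> rfl

theorem blockB_transpose (y u w : ℂ) : (blockB y u w)ᵀ = blockB y w u := by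
  ext i j
  fin_cases i <;> fin_cases j <;> rfl

theorem BC9Ab_mem_orbit : BC9Ab ∈ BC9Orbit := by
  -- Taking `u = w` makes the off-diagonal block symmetric, and the sum is `ω - ω ^ 2 - 2 ω = 1`.
  refine ⟨omega, -omega ^ 2, -omega, -omega, norm_omega, ?_, ?_, ?_, ?_, ?_⟩
  · simp [norm_omega]
  · simp [norm_omega]
  · simp [norm_omega]
  · rw [omega_sq]; ring
  · rw [BC9Ab, BC9, smul_C3_conjTranspose, blockB_transpose]
    rfl

/-- `BC9` is a symmetric matrix: transposing the block array exchanges `B` and `Bᵀ`, and transposing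
inside the blocks exchanges them back. Only conjugation of the parameters remains. -/
theorem BC9_conjTranspose (x y u w : ℂ) :
    (BC9 x y u w)ᴴ = BC9 (star x) (star y) (star u) (star w) := by
  have hA : ∀ i j, star (blockA x j i) = blockA (star x) i j := by
    intro i j
    fin_cases i <;> fin_cases j <;> first | exact star_one _ | rfl
  have hB : ∀ i j, star (blockB y u w j i) = blockB (star y) (star u) (star w) j i := by
    intro i j
    fin_cases i <;> fin_cases j <;> rfl
  ext ⟨a, i⟩ ⟨b, j⟩
  fin_cases a <;> fin_cases b <;> first | exact hA i j | exact hB i j | exact hB j i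

theorem conjTranspose_mem_BC9Orbit {H : Matrix (Fin 3 × Fin 3) (Fin 3 × Fin 3) ℂ}
    (h : H ∈ BC9Orbit) : Hᴴ ∈ BC9Orbit := by
  obtain ⟨x, y, u, w, hx, hy, hu, hw, hs, rfl⟩ := h
  refine ⟨star x, star y, star u, star w, by simpa, by simpa, by simpa, by simpa, ?_,
    BC9_conjTranspose x y u w⟩
  simpa using congrArg star hs

/-! ### The Butson property and the defect as integer computations. -/

/-- `conj (zeta ^ E i j) * zeta ^ E i k` has this exponent, reduced modulo `6`. -/
def diffExpo (E : ℕ → ℕ → ℕ) (j k i : ℕ) : ℕ := (E i k + 5 * E i j) % 6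

theorem star_mul_rootMatrix (E : ℕ → ℕ → ℕ) (i j k : Fin 3 × Fin 3) :
    star (rootMatrix E i j) * rootMatrix E i k =
      (coordOne (diffExpo E (idx j) (idx k) (idx i)) : ℂ) +
      coordOmega (diffExpo E (idx j) (idx k) (idx i)) *
        omega := by
  rw [rootMatrix_apply, rootMatrix_apply, star_zeta_pow, mul_comm, ← pow_add, zeta_pow_eq, diffExpo]

theorem sum_star_mul_rootMatrix (E : ℕ → ℕ → ℕ) (j k : Fin 3 × Fin 3)
    (x : Fin 3 × Fin 3 → ℝ) :
    ∑ i, star (rootMatrix E i j) * rootMatrix E i k * (x i : ℂ) =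
      ((∑ i, (coordOne (diffExpo E (idx j) (idx k)
        (idx i)) : ℝ) * x i : ℝ) : ℂ) +
      ((∑ i, (coordOmega (diffExpo E (idx j) (idx k)
        (idx i)) : ℝ) * x i : ℝ) : ℂ) * omega := by
  push_cast
  rw [Finset.sum_mul, ← Finset.sum_add_distrib]
  refine Finset.sum_congr rfl fun i _ => ?_
  rw [star_mul_rootMatrix]
  ring

theorem isButson_rootMatrix {E : ℕ → ℕ → ℕ}
    (h1 : ∀ j k : Fin 9, ∑ i : Fin 9, coordOne (diffExpo E j k i) = if j = k then 9 else 0)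
    (h2 : ∀ j k : Fin 9, ∑ i : Fin 9, coordOmega (diffExpo E j k i) = 0) :
    IsButson 6 (rootMatrix E) := by
  refine ⟨⟨fun p q => norm_zeta_pow _, ?_⟩, fun p q => ?_⟩
  · ext j k
    have h := sum_star_mul_rootMatrix E j k fun _ => 1
    simp only [mul_one, Complex.ofReal_one] at h
    rw [Matrix.mul_apply]
    simp only [Matrix.conjTranspose_apply]
    rw [h, idx.sum_comp (fun i : Fin 9 =>
        (coordOne (diffExpo E (idx j) (idx k) i) : ℝ)),
      idx.sum_comp (fun i : Fin 9 =>
        (coordOmega (diffExpo E (idx j) (idx k) i) : ℝ)),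
      ← Int.cast_sum, ← Int.cast_sum, h1 (idx j) (idx k),
      h2 (idx j) (idx k)]
    by_cases hjk : j = k <;> simp [hjk]
  · rw [rootMatrix_apply, ← pow_mul, mul_comm, pow_mul, zeta_pow_six, one_pow]

theorem mem_phaseSpace {n : Type*} [Fintype n] {H : Matrix n n ℂ} {R : Matrix n n ℝ} :
    R ∈ phaseSpace H ↔
      ∀ j k, ∑ i, star (H i j) * H i k * ((R i k : ℂ) - (R i j : ℂ)) = 0 := Iff.rfl

/-- Since `R` is real, the constraints for `(j, k)` and `(k, j)` are equivalent, so the system needs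
only the pairs `k < j`. -/
theorem sum_phase_comm {n : Type*} [Fintype n] (H : Matrix n n ℂ) (R : Matrix n n ℝ) (j k : n) :
    ∑ i, star (H i k) * H i j * ((R i j : ℂ) - (R i k : ℂ)) =
      -star (∑ i, star (H i j) * H i k * ((R i k : ℂ) - (R i j : ℂ))) := by
  rw [star_sum, ← Finset.sum_neg_distrib]
  refine Finset.sum_congr rfl fun i _ => ?_
  simp only [star_mul', Complex.star_def, Complex.conj_ofReal, map_sub, Complex.conj_conj]
  ring

/-- The coefficients of one real equation of the linearized unitarity constraint for the columns
`j, k`. The coefficient of the phase in row `i` and column `l` stands at position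
`80 - (9 i + l)`. -/
def phaseRow (E : ℕ → ℕ → ℕ) (c : ℕ → ℤ) (j k : ℕ) : List ℤ :=
  (List.range 81).reverse.map fun v =>
    if v % 9 = k then c (diffExpo E j k (v / 9))
    else if v % 9 = j then -c (diffExpo E j k (v / 9)) else 0

/-- The real equations of the linearized unitarity constraint. -/
def phaseRows (E : ℕ → ℕ → ℕ) : List (List ℤ) :=
  (List.range 9).flatMap fun j => (List.range j).flatMap fun k =>
    [phaseRow E coordOne j k, phaseRow E coordOmega j k]

theorem mem_phaseRows {E : ℕ → ℕ → ℕ} {r : List ℤ} : r ∈ phaseRows E ↔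
    ∃ j k : Fin 9, k < j ∧ (r = phaseRow E coordOne j k ∨ r = phaseRow E coordOmega j k) := by
  simp only [phaseRows, List.mem_flatMap, List.mem_range, List.mem_cons, List.not_mem_nil, or_false]
  constructor
  · rintro ⟨j, hj, k, hk, h⟩
    exact ⟨⟨j, hj⟩, ⟨k, hk.trans hj⟩, hk, h⟩
  · rintro ⟨j, k, hk, h⟩
    exact ⟨j, j.2, k, hk, h⟩

/-- Positions in a list of `81` coefficients, read backwards, as positions in a `9 × 9` matrix. -/
def posEquiv : Fin 9 × Fin 9 ≃ Fin 81 := (finProdFinEquiv (m := 9) (n := 9)).trans Fin.revPerm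

theorem dot_phaseRow (E : ℕ → ℕ → ℕ) (c : ℕ → ℤ) {j k : Fin 9} (hjk : k ≠ j) (x : Fin 81 → ℝ) :
    dot (phaseRow E c j k) x = ∑ i : Fin 9, (c (diffExpo E j k i) : ℝ) *
      (x (posEquiv (i, k)) - x (posEquiv (i, j))) := by
  have hg : ∀ i l : Fin 9, (phaseRow E c j k).getD (posEquiv (i, l)) 0 =
      if l = k then c (diffExpo E j k i) else if l = j then -c (diffExpo E j k i) else 0 := by
    intro i l
    have hv : ((posEquiv (i, l) : Fin 81) : ℕ) = 80 - (l + 9 * i) := by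
      simp only [posEquiv, Equiv.trans_apply, Fin.revPerm_apply, Fin.val_rev,
        finProdFinEquiv_apply_val]
      omega
    have hlt : ((posEquiv (i, l) : Fin 81) : ℕ) < (phaseRow E c j k).length := by
      simp only [phaseRow, List.length_map, List.length_reverse, List.length_range]
      exact (posEquiv (i, l)).2
    rw [List.getD_eq_getElem _ _ hlt]
    simp only [phaseRow, List.getElem_map, List.getElem_reverse, List.length_range,
      List.getElem_range, hv]
    have e1 : (81 - 1 - (80 - ((l : ℕ) + 9 * i))) % 9 = l := by omega
    have e2 : (81 - 1 - (80 - ((l : ℕ) + 9 * i))) / 9 = i := by omega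
    simp only [e1, e2, Fin.ext_iff]
  rw [dot, ← posEquiv.sum_comp, Fintype.sum_prod_type]
  refine Finset.sum_congr rfl fun i _ => ?_
  simp only [hg]
  -- Only the columns `l = k` and `l = j` have nonzero coefficients in this row.
  rw [← Finset.add_sum_erase _ _ (Finset.mem_univ k), if_pos rfl,
    ← Finset.add_sum_erase _ _ (Finset.mem_erase.2 ⟨hjk.symm, Finset.mem_univ j⟩),
    if_neg hjk.symm, if_pos rfl, Finset.sum_eq_zero]
  · push_cast; ring
  · intro l hl
    simp only [Finset.mem_erase] at hl
    rw [if_neg hl.2.1, if_neg hl.1, Int.cast_zero, zero_mul]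

/-- The phases of a matrix, as a list of `81` variables. -/
def phaseEquiv : Matrix (Fin 3 × Fin 3) (Fin 3 × Fin 3) ℝ ≃ₗ[ℝ] (Fin 81 → ℝ) where
  toFun R v := R (idx.symm (posEquiv.symm v).1)
    (idx.symm (posEquiv.symm v).2)
  invFun x := Matrix.of fun p q => x (posEquiv (idx p, idx q))
  map_add' _ _ := rfl
  map_smul' _ _ := rfl
  left_inv R := by ext p q; simp
  right_inv x := by ext v; simp

theorem phaseEquiv_apply (R : Matrix (Fin 3 × Fin 3) (Fin 3 × Fin 3) ℝ) (v : Fin 81) :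
    phaseEquiv R v = R (idx.symm (posEquiv.symm v).1) (idx.symm (posEquiv.symm v).2) := rfl

theorem mem_phaseSpace_rootMatrix {E : ℕ → ℕ → ℕ}
    {R : Matrix (Fin 3 × Fin 3) (Fin 3 × Fin 3) ℝ} :
    R ∈ phaseSpace (rootMatrix E) ↔ phaseEquiv R ∈ sol 81 (phaseRows E) := by
  have key : ∀ (c : ℕ → ℤ) (j k : Fin 3 × Fin 3), k ≠ j →
      dot (phaseRow E c (idx j) (idx k)) (phaseEquiv R) =
      ∑ i, (c (diffExpo E (idx j) (idx k) (idx i)) : ℝ) *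
        (R i k - R i j) := by
    intro c j k hjk
    have hjk' : (idx k : Fin 9) ≠ idx j :=
      fun h => hjk (idx.injective h)
    rw [dot_phaseRow E c hjk', ← idx.sum_comp]
    refine Finset.sum_congr rfl fun i _ => ?_
    simp [phaseEquiv_apply]
  have key2 : ∀ j k : Fin 3 × Fin 3, k ≠ j →
      ((∑ i, star (rootMatrix E i j) * rootMatrix E i k * ((R i k : ℂ) - (R i j : ℂ)) = 0) ↔
      dot (phaseRow E coordOne (idx j) (idx k)) (phaseEquiv R) = 0 ∧
      dot (phaseRow E coordOmega (idx j) (idx k)) (phaseEquiv R) = 0) := by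
    intro j k hjk
    rw [key _ j k hjk, key _ j k hjk, ← add_mul_omega_eq_zero,
      ← sum_star_mul_rootMatrix E j k fun i => R i k - R i j]
    simp only [Complex.ofReal_sub]
  rw [mem_phaseSpace, mem_sol]
  constructor
  · intro h r hr
    obtain ⟨j, k, hjk, hr⟩ := mem_phaseRows.1 hr
    obtain ⟨j, rfl⟩ := idx.surjective j
    obtain ⟨k, rfl⟩ := idx.surjective k
    have := (key2 j k fun h => hjk.ne (congrArg _ h)).1 (h j k)
    rcases hr with rfl | rfl
    exacts [this.1, this.2]
  · intro h j k
    have main : ∀ j k : Fin 3 × Fin 3, (idx k : Fin 9) < idx j →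
        ∑ i, star (rootMatrix E i j) * rootMatrix E i k * ((R i k : ℂ) - (R i j : ℂ)) = 0 :=
      fun j k hjk => (key2 j k fun h => hjk.ne (congrArg _ h)).2
        ⟨h _ (mem_phaseRows.2 ⟨_, _, hjk, Or.inl rfl⟩),
          h _ (mem_phaseRows.2 ⟨_, _, hjk, Or.inr rfl⟩)⟩
    rcases lt_trichotomy (idx k : Fin 9) (idx j) with hjk | hjk | hjk
    · exact main j k hjk
    · rw [idx.injective hjk]
      simp
    · rw [sum_phase_comm, main k j hjk, star_zero, neg_zero]

theorem finrank_phaseSpace_rootMatrix (E : ℕ → ℕ → ℕ) :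
    Module.finrank ℝ (phaseSpace (rootMatrix E)) + lrank 81 (phaseRows E) = 81 := by
  have h : phaseSpace (rootMatrix E) =
      (sol 81 (phaseRows E)).comap (phaseEquiv : _ →ₗ[ℝ] (Fin 81 → ℝ)) := by
    ext R
    exact mem_phaseSpace_rootMatrix
  rw [h, (phaseEquiv.ofSubmodule' (sol 81 (phaseRows E))).finrank_eq, add_comm,
    lrank_add_finrank_sol]

/-- Each equation is replaced by its complex conjugate, and the unknowns are real. -/
theorem phaseSpace_map_star {n : Type*} [Fintype n] (H : Matrix n n ℂ) :
    phaseSpace (H.map star) = phaseSpace H := by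
  ext R
  refine forall₂_congr fun j k => ?_
  rw [← star_eq_zero, star_sum]
  refine Eq.congr_left (Finset.sum_congr rfl fun i _ => ?_)
  simp only [Matrix.map_apply, star_mul', star_sub, Complex.star_def,
    Complex.conj_ofReal, Complex.conj_conj]

theorem lrank_phaseRows_expo : lrank 81 (phaseRows expo) = 54 := by decide +kernel

theorem defect_BC9Ab : defect BC9Ab = 10 := by
  have h := finrank_phaseSpace_rootMatrix expo
  rw [lrank_phaseRows_expo, ← BC9Ab_eq] at h
  have h' : Module.finrank ℝ (phaseSpace BC9Ab) = 27 := by omega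
  simp [defect, h']

theorem BC9Ab_transpose : BC9Abᵀ = BC9Ab := by
  ext p q
  rw [BC9Ab_eq, Matrix.transpose_apply, rootMatrix_apply, rootMatrix_apply, expo_comm]

theorem defect_BC9Ab_conjTranspose : defect BC9Abᴴ = 10 := by
  rw [← defect_BC9Ab, Matrix.conjTranspose, BC9Ab_transpose, defect, defect, phaseSpace_map_star]

theorem isButson_BC9Ab : IsButson 6 BC9Ab := by
  rw [BC9Ab_eq]
  exact isButson_rootMatrix (by decide +kernel) (by decide +kernel)

theorem isButson_BC9Ab_conjTranspose : IsButson 6 BC9Abᴴ := by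
  rw [BC9Ab_conjTranspose_eq]
  exact isButson_rootMatrix (by decide +kernel) (by decide +kernel)

/-! ### Invariants of equivalence. -/

theorem Equivalent.exists_apply_eq {n : Type*} [Fintype n] [DecidableEq n] {H K : Matrix n n ℂ}
    (h : Equivalent H K) : ∃ (σ τ : Equiv.Perm n) (d e : n → ℂ), (∀ i, d i ≠ 0) ∧ (∀ i, e i ≠ 0) ∧
      ∀ i j, H i j = d i * K (σ i) (τ j) * e j := by
  obtain ⟨σ, τ, d, e, hd, he, rfl⟩ := h
  refine ⟨σ, τ.symm, fun i => d (σ i), fun j => e (τ.symm j),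
    fun i => norm_ne_zero_iff.1 (by simp [hd]), fun i => norm_ne_zero_iff.1 (by simp [he]),
    fun i j => ?_⟩
  rw [Equiv.Perm.permMatrix, Equiv.Perm.permMatrix, PEquiv.mul_toMatrix_toPEquiv,
    Matrix.submatrix_apply, id, Matrix.mul_diagonal, Matrix.mul_assoc,
    PEquiv.toMatrix_toPEquiv_mul, Matrix.submatrix_apply, Matrix.diagonal_mul]
  rfl

/-- Every row lies in a triple of rows such that every column is, on these three rows, proportional
to some other column. -/
def HasParallelTriples {n : Type*} (H : Matrix n n ℂ) : Prop :=
  ∀ p, ∃ p' p'', p' ≠ p ∧ p'' ≠ p ∧ p' ≠ p'' ∧ ∀ q, ∃ q', q' ≠ q ∧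
    H p q * H p' q' = H p' q * H p q' ∧ H p q * H p'' q' = H p'' q * H p q'

theorem Equivalent.hasParallelTriples {n : Type*} [Fintype n] [DecidableEq n] {H K : Matrix n n ℂ}
    (h : Equivalent H K) (hK : HasParallelTriples K) : HasParallelTriples H := by
  obtain ⟨σ, τ, d, e, -, -, hH⟩ := h.exists_apply_eq
  intro p
  obtain ⟨p', p'', h1, h2, h3, h4⟩ := hK (σ p)
  obtain ⟨p', rfl⟩ := σ.surjective p'
  obtain ⟨p'', rfl⟩ := σ.surjective p''
  refine ⟨p', p'', ne_of_apply_ne _ h1, ne_of_apply_ne _ h2, ne_of_apply_ne _ h3, fun q => ?_⟩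
  obtain ⟨q', h5, h6, h7⟩ := h4 (τ q)
  obtain ⟨q', rfl⟩ := τ.surjective q'
  refine ⟨q', ne_of_apply_ne _ h5, ?_, ?_⟩
  · simp only [hH]
    linear_combination d p * d p' * e q * e q' * h6
  · simp only [hH]
    linear_combination d p * d p'' * e q * e q' * h7

/-- The property quantifies over all rows, so it is refuted in row `0` alone, where it becomes a
finite check of exponents modulo `6`. -/
theorem not_hasParallelTriples_rootMatrix {E : ℕ → ℕ → ℕ}
    (h : ¬ ∃ p' p'' : Fin 9, p' ≠ 0 ∧ p'' ≠ 0 ∧ p' ≠ p'' ∧ ∀ q : Fin 9, ∃ q' : Fin 9, q' ≠ q ∧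
      (E 0 q + E p' q') % 6 = (E p' q + E 0 q') % 6 ∧
      (E 0 q + E p'' q') % 6 = (E p'' q + E 0 q') % 6) :
    ¬ HasParallelTriples (rootMatrix E) := by
  intro hE
  obtain ⟨p', p'', h1, h2, h3, h4⟩ := hE (idx.symm 0)
  refine h ⟨idx p', idx p'', ?_, ?_, idx.injective.ne h3, fun q => ?_⟩
  · rwa [ne_eq, ← idx.eq_symm_apply]
  · rwa [ne_eq, ← idx.eq_symm_apply]
  obtain ⟨q', h5, h6, h7⟩ := h4 (idx.symm q)
  simp only [rootMatrix_apply, Equiv.apply_symm_apply, ← pow_add, zeta_pow_inj] at h6 h7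
  exact ⟨idx q', by rwa [ne_eq, ← idx.eq_symm_apply], h6, h7⟩

theorem not_hasParallelTriples_BC9Ab : ¬ HasParallelTriples BC9Ab := by
  rw [BC9Ab_eq]
  exact not_hasParallelTriples_rootMatrix (by decide +kernel)

theorem not_hasParallelTriples_BC9Ab_conjTranspose : ¬ HasParallelTriples BC9Abᴴ := by
  rw [BC9Ab_conjTranspose_eq]
  exact not_hasParallelTriples_rootMatrix (by decide +kernel)

/-- A relation between two columns `j, j'` relative to three rows, invariant under equivalence. -/
def OmegaRelated {n : Type*} (H : Matrix n n ℂ) (i k l j j' : n) : Prop :=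
  H k j * H l j * H i j' ^ 2 = omega * (H k j' * H l j' * H i j ^ 2)

/-- Both sides of the relation carry the same factor `d k * d l * d i ^ 2 * e j ^ 2 * e j' ^ 2`,
which is nonzero and cancels. -/
theorem omegaRelated_iff {n : Type*} {H K : Matrix n n ℂ} {σ τ : Equiv.Perm n} {d e : n → ℂ}
    (hd : ∀ i, d i ≠ 0) (he : ∀ i, e i ≠ 0) (hH : ∀ i j, H i j = d i * K (σ i) (τ j) * e j)
    (i k l j j' : n) :
    OmegaRelated H i k l j j' ↔ OmegaRelated K (σ i) (σ k) (σ l) (τ j) (τ j') := by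
  have hc : d k * d l * d i ^ 2 * e j ^ 2 * e j' ^ 2 ≠ 0 := by
    simp [hd, he]
  simp only [OmegaRelated, hH]
  constructor
  · intro h
    apply mul_left_cancel₀ hc
    linear_combination h
  · intro h
    linear_combination d k * d l * d i ^ 2 * e j ^ 2 * e j' ^ 2 * h

/-- Every row lies in a triple of rows for which some column has six related columns. -/
def IsPositive {n : Type*} (H : Matrix n n ℂ) : Prop :=
  ∀ i, ∃ k l j, k ≠ i ∧ l ≠ i ∧ k ≠ l ∧ Nat.card {j' // OmegaRelated H i k l j j'} = 6

theorem Equivalent.isPositive {n : Type*} [Fintype n] [DecidableEq n] {H K : Matrix n n ℂ}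
    (h : Equivalent H K) (hH : IsPositive H) : IsPositive K := by
  obtain ⟨σ, τ, d, e, hd, he, hHK⟩ := h.exists_apply_eq
  intro i
  obtain ⟨i, rfl⟩ := σ.surjective i
  obtain ⟨k, l, j, h1, h2, h3, h4⟩ := hH i
  refine ⟨σ k, σ l, τ j, σ.injective.ne h1, σ.injective.ne h2, σ.injective.ne h3, ?_⟩
  rw [← h4]
  exact (Nat.card_congr (τ.subtypeEquiv fun j' => omegaRelated_iff hd he hHK i k l j j')).symm

theorem card_omegaRelated_rootMatrix (E : ℕ → ℕ → ℕ) (i k l j : Fin 3 × Fin 3) :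
    Nat.card {j' // OmegaRelated (rootMatrix E) i k l j j'} =
      (Finset.univ.filter fun j' : Fin 9 =>
        (E (idx k) (idx j) + E (idx l) (idx j) + E (idx i) j' * 2) % 6 =
          (2 + (E (idx k) j' + E (idx l) j' + E (idx i) (idx j) * 2)) % 6).card := by
  rw [← Fintype.card_subtype, ← Nat.card_eq_fintype_card]
  refine Nat.card_congr (idx.subtypeEquiv fun j' => ?_)
  simp only [OmegaRelated, rootMatrix_apply, ← zeta_pow_two, ← pow_add, ← pow_mul, zeta_pow_inj]

/-- The three rows of one block serve as the triple: `H k j * H l j / H i j ^ 2` equals `ω ^ 2` on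
the three columns of the same block and `ω` on the other six. Conjugation exchanges these two
values, which reverses the relation. -/
theorem isPositive_BC9Ab : IsPositive BC9Ab := by
  have key : ∀ i : Fin 9, ∃ k l j : Fin 9, k ≠ i ∧ l ≠ i ∧ k ≠ l ∧
      (Finset.univ.filter fun j' : Fin 9 => (expo k j + expo l j + expo i j' * 2) % 6 =
        (2 + (expo k j' + expo l j' + expo i j * 2)) % 6).card = 6 := by
    decide +kernel
  rw [BC9Ab_eq]
  intro i
  obtain ⟨k, l, j, h1, h2, h3, h4⟩ := key (idx i)
  refine ⟨idx.symm k, idx.symm l, idx.symm j, ?_, ?_, idx.symm.injective.ne h3, ?_⟩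
  · rwa [ne_eq, idx.symm_apply_eq]
  · rwa [ne_eq, idx.symm_apply_eq]
  · simpa only [card_omegaRelated_rootMatrix, Equiv.apply_symm_apply] using h4

theorem not_isPositive_BC9Ab_conjTranspose : ¬ IsPositive BC9Abᴴ := by
  have key : ¬ ∃ k l j : Fin 9, k ≠ 0 ∧ l ≠ 0 ∧ k ≠ l ∧
      (Finset.univ.filter fun j' : Fin 9 =>
        (5 * expo k j + 5 * expo l j + 5 * expo 0 j' * 2) % 6 =
        (2 + (5 * expo k j' + 5 * expo l j' + 5 * expo 0 j * 2)) % 6).card = 6 := by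
    decide +kernel
  rw [BC9Ab_conjTranspose_eq]
  intro h
  obtain ⟨k, l, j, h1, h2, h3, h4⟩ := h (idx.symm 0)
  refine key ⟨idx k, idx l, idx j, ?_, ?_, idx.injective.ne h3, ?_⟩
  · rwa [ne_eq, ← idx.eq_symm_apply]
  · rwa [ne_eq, ← idx.eq_symm_apply]
  · rw [card_omegaRelated_rootMatrix, Equiv.apply_symm_apply] at h4
    exact h4

theorem not_equivalent_BC9Ab_conjTranspose : ¬ Equivalent BC9Ab BC9Abᴴ :=
  fun h => not_isPositive_BC9Ab_conjTranspose (h.isPositive isPositive_BC9Ab)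

/-! ### Characters of `ℤ/3` and Fourier inversion. -/

/-- The additive character `a ↦ ω ^ a` of `ℤ/3`. -/
def chi (a : Fin 3) : ℂ := omega ^ (a : ℕ)

theorem chi_add (a b : Fin 3) : chi (a + b) = chi a * chi b := by
  rw [chi, chi, chi, ← pow_add, Fin.val_add, ← pow_eq_pow_mod _ omega_pow_three]

theorem chi_zero : chi 0 = 1 := pow_zero _

theorem norm_chi (a : Fin 3) : ‖chi a‖ = 1 := by rw [chi, norm_pow, norm_omega, one_pow]

theorem star_chi (a : Fin 3) : star (chi a) = chi (-a) := by
  rw [star_eq_inv (norm_chi a)]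
  refine inv_eq_of_mul_eq_one_right ?_
  rw [← chi_add, add_neg_cancel, chi_zero]

theorem star_chi_mul_chi (a b c : Fin 3) :
    star (chi (a * b)) * chi (a * c) = chi (a * (c - b)) := by
  rw [star_chi, ← chi_add]
  congr 1
  revert a b c
  decide

theorem chi_mul_star_chi (p q k : Fin 3) :
    chi (p * k) * star (chi (q * k)) = chi ((p - q) * k) := by
  rw [star_chi, ← chi_add]
  congr 1
  revert p q k
  decide

theorem sum_chi (d : Fin 3) : ∑ j, chi (d * j) = if d = 0 then 3 else 0 := by
  have h0 : chi 0 + chi 1 + chi 2 = 0 := by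
    simp only [chi, Fin.val_zero, Fin.val_one, Fin.val_two, omega_sq]
    ring
  rw [Fin.sum_univ_three]
  fin_cases d
  · norm_num [chi_zero]
  · exact h0
  · exact (add_right_comm _ _ _).trans h0

theorem sum_chi_mul_star_chi (p i : Fin 3) :
    ∑ j, chi (p * j) * star (chi (i * j)) = if p = i then 3 else 0 := by
  simp only [chi_mul_star_chi, sum_chi]
  congr 1
  revert p i
  decide

theorem eq_zero_of_sum_star_chi_eq_zero {f : Fin 3 → ℂ}
    (h : ∀ p, ∑ j, star (chi (p * j)) * f j = 0) (j : Fin 3) : f j = 0 := by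
  -- Fourier inversion: transforming the vanishing transform back recovers `3 * f j`.
  have h1 : ∑ p, chi (j * p) * ∑ i, star (chi (p * i)) * f i = 3 * f j := by
    simp only [Finset.mul_sum]
    rw [Finset.sum_comm]
    have : ∀ i, ∑ p, chi (j * p) * (star (chi (p * i)) * f i) =
        (if j = i then 3 else 0) * f i := by
      intro i
      rw [← sum_chi_mul_star_chi, Finset.sum_mul]
      refine Finset.sum_congr rfl fun p _ => ?_
      rw [mul_comm p i, mul_assoc]
    simp only [this, ite_mul, zero_mul, Finset.sum_ite_eq, Finset.mem_univ, if_true]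
  simp only [h, mul_zero, Finset.sum_const_zero] at h1
  simpa using h1.symm

theorem eq_zero_of_sum_chi_eq_zero {f : Fin 3 → ℂ}
    (h : ∀ p, ∑ j, chi (p * j) * f j = 0) (j : Fin 3) : f j = 0 := by
  rw [← star_eq_zero]
  refine eq_zero_of_sum_star_chi_eq_zero (f := fun j => star (f j)) (fun p => ?_) j
  simpa using congrArg star (h p)

/-! ### The Fourier family: entries, invariant, Butson members. -/

/-- The phases `Δ_b` in the block form of the Fourier family. -/
def delta (x₁ x₂ x₃ x₄ : ℂ) : Fin 3 → Fin 3 → ℂ := ![![1, 1, 1], ![1, x₁, x₂], ![1, x₃, x₄]]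

theorem F3_apply (i j : Fin 3) : F3 i j = chi (i * j) := by
  fin_cases i <;> fin_cases j <;> simp [F3, chi]

theorem F9_apply (x₁ x₂ x₃ x₄ : ℂ) (a i b j : Fin 3) :
    F9 x₁ x₂ x₃ x₄ (a, i) (b, j) = chi (a * b) * delta x₁ x₂ x₃ x₄ b i * chi (i * j) := by
  have h0 : F3 i j = chi 0 * delta x₁ x₂ x₃ x₄ 0 i * F3 i j := by
    rw [chi_zero]
    fin_cases i <;> simp [delta]
  have h1 : ∀ v : Fin 3 → ℂ, (Matrix.diagonal v * F3) i j = chi 0 * v i * F3 i j := by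
    intro v
    rw [Matrix.diagonal_mul, chi_zero, one_mul]
  have h2 : ∀ (z : ℂ) (m : Fin 3) (v : Fin 3 → ℂ), chi m = z →
      (z • (Matrix.diagonal v * F3)) i j = chi m * v i * F3 i j := by
    rintro z m v rfl
    rw [Matrix.smul_apply, Matrix.diagonal_mul, smul_eq_mul, mul_assoc]
  have c1 : chi 1 = omega := pow_one _
  have c2 : chi 2 = omega ^ 2 := rfl
  rw [← F3_apply i j]
  fin_cases a <;> fin_cases b
  · exact h0
  · exact h1 _
  · exact h1 _
  · exact h0
  · exact h2 _ 1 _ c1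
  · exact h2 _ 2 _ c2
  · exact h0
  · exact h2 _ 2 _ c2
  · exact h2 _ 1 _ c1

/-- In the rows `(a, i)` with `i` fixed, the ratios of entries of column `(b, j)` depend only on
`b`, so any other column of the same block is proportional. -/
theorem hasParallelTriples_F9 (x₁ x₂ x₃ x₄ : ℂ) : HasParallelTriples (F9 x₁ x₂ x₃ x₄) := by
  rintro ⟨a, i⟩
  refine ⟨(a + 1, i), (a + 2, i), ?_, ?_, ?_, ?_⟩
  · simp
  · simp only [ne_eq, Prod.mk.injEq, and_true]; revert a; decide
  · simp only [ne_eq, Prod.mk.injEq, and_true]; revert a; decide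
  rintro ⟨b, j⟩
  refine ⟨(b, j + 1), by simp, ?_, ?_⟩ <;>
  · simp only [F9_apply]
    ring

theorem norm_delta {x₁ x₂ x₃ x₄ : ℂ} (h₁ : ‖x₁‖ = 1) (h₂ : ‖x₂‖ = 1) (h₃ : ‖x₃‖ = 1)
    (h₄ : ‖x₄‖ = 1) (b i : Fin 3) : ‖delta x₁ x₂ x₃ x₄ b i‖ = 1 := by
  fin_cases b <;> fin_cases i <;> simp [delta, *]

theorem isHadamard_F9 {x₁ x₂ x₃ x₄ : ℂ} (h₁ : ‖x₁‖ = 1) (h₂ : ‖x₂‖ = 1) (h₃ : ‖x₃‖ = 1)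
    (h₄ : ‖x₄‖ = 1) : IsHadamard (F9 x₁ x₂ x₃ x₄) := by
  have hd := norm_delta h₁ h₂ h₃ h₄
  refine ⟨?_, ?_⟩
  · rintro ⟨a, i⟩ ⟨b, j⟩
    rw [F9_apply, norm_mul, norm_mul, norm_chi, norm_chi, hd, one_mul, one_mul]
  · ext ⟨b, j⟩ ⟨c, k⟩
    rw [Matrix.mul_apply, Fintype.sum_prod_type]
    simp only [Matrix.conjTranspose_apply, F9_apply, star_mul']
    have h : ∀ a i, star (chi (a * b)) * star (delta x₁ x₂ x₃ x₄ b i) * star (chi (i * j)) *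
        (chi (a * c) * delta x₁ x₂ x₃ x₄ c i * chi (i * k)) =
        chi ((c - b) * a) * (star (delta x₁ x₂ x₃ x₄ b i) * delta x₁ x₂ x₃ x₄ c i *
          chi ((k - j) * i)) := by
      intro a i
      rw [mul_comm (c - b), mul_comm (k - j), ← star_chi_mul_chi, ← star_chi_mul_chi]
      ring
    simp only [h, ← Finset.mul_sum, ← Finset.sum_mul, sum_chi]
    by_cases hbc : c = b
    · subst hbc
      have h' : ∀ i, star (delta x₁ x₂ x₃ x₄ c i) * delta x₁ x₂ x₃ x₄ c i = 1 := by
        intro i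
        rw [star_eq_inv (hd c i), inv_mul_cancel₀ (norm_ne_zero_iff.1 (by simp [hd]))]
      simp only [h', one_mul, sum_chi, sub_self, sub_eq_zero]
      by_cases hjk : k = j
      · simp [hjk]; norm_num
      · simp [hjk, Ne.symm hjk]
    · simp [sub_eq_zero, hbc, Ne.symm hbc]

theorem isButson_F9_iff {x₁ x₂ x₃ x₄ : ℂ} (h₁ : ‖x₁‖ = 1) (h₂ : ‖x₂‖ = 1) (h₃ : ‖x₃‖ = 1)
    (h₄ : ‖x₄‖ = 1) :
    IsButson 6 (F9 x₁ x₂ x₃ x₄) ↔ x₁ ^ 6 = 1 ∧ x₂ ^ 6 = 1 ∧ x₃ ^ 6 = 1 ∧ x₄ ^ 6 = 1 := by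
  -- The columns `(b, 0)` in the first block row display the parameters themselves.
  have e : ∀ b i, F9 x₁ x₂ x₃ x₄ (0, i) (b, 0) = delta x₁ x₂ x₃ x₄ b i := by
    intro b i
    rw [F9_apply, zero_mul, mul_zero, chi_zero, one_mul, mul_one]
  constructor
  · intro h
    have h' : ∀ b i, delta x₁ x₂ x₃ x₄ b i ^ 6 = 1 := fun b i => e b i ▸ h.2 (0, i) (b, 0)
    exact ⟨h' 1 1, h' 1 2, h' 2 1, h' 2 2⟩
  · rintro ⟨e₁, e₂, e₃, e₄⟩
    refine ⟨isHadamard_F9 h₁ h₂ h₃ h₄, ?_⟩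
    rintro ⟨a, i⟩ ⟨b, j⟩
    have h' : delta x₁ x₂ x₃ x₄ b i ^ 6 = 1 := by
      fin_cases b <;> fin_cases i <;> simp [delta, *]
    have hc : ∀ a, chi a ^ 6 = 1 := fun a => by
      rw [chi, ← pow_mul, mul_comm, pow_mul, show 6 = 3 * 2 from rfl, pow_mul, omega_pow_three,
        one_pow, one_pow]
    rw [F9_apply, mul_pow, mul_pow, hc, hc, h', one_mul, one_mul]

theorem F9_injective {x y : ℂ × ℂ × ℂ × ℂ}
    (h : F9 x.1 x.2.1 x.2.2.1 x.2.2.2 = F9 y.1 y.2.1 y.2.2.1 y.2.2.2) : x = y := by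
  have h' : ∀ b i, delta x.1 x.2.1 x.2.2.1 x.2.2.2 b i = delta y.1 y.2.1 y.2.2.1 y.2.2.2 b i := by
    intro b i
    have := congrFun (congrFun h (0, i)) (b, 0)
    simpa only [F9_apply, zero_mul, mul_zero, chi_zero, one_mul, mul_one] using this
  exact Prod.ext (h' 1 1) (Prod.ext (h' 1 2) (Prod.ext (h' 2 1) (h' 2 2)))

theorem ncard_F9Orbit_isButson : {K ∈ F9Orbit | IsButson 6 K}.ncard = 6 ^ 4 := by
  let S : Finset ℂ := Polynomial.nthRootsFinset 6 (1 : ℂ)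
  have hS : ∀ z : ℂ, z ∈ S ↔ z ^ 6 = 1 := fun z => Polynomial.mem_nthRootsFinset (by norm_num) _
  have hcard : S.card = 6 :=
    (Complex.isPrimitiveRoot_exp 6 (by norm_num)).card_nthRootsFinset
  have h : {K ∈ F9Orbit | IsButson 6 K} =
      (fun x : ℂ × ℂ × ℂ × ℂ => F9 x.1 x.2.1 x.2.2.1 x.2.2.2) ''
        ((S ×ˢ S ×ˢ S ×ˢ S : Finset (ℂ × ℂ × ℂ × ℂ)) : Set (ℂ × ℂ × ℂ × ℂ)) := by
    ext K
    simp only [Set.mem_ofPred_eq, Set.mem_image, Finset.mem_coe, Finset.mem_product, hS]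
    constructor
    · rintro ⟨⟨x₁, x₂, x₃, x₄, h₁, h₂, h₃, h₄, rfl⟩, hB⟩
      exact ⟨(x₁, x₂, x₃, x₄), (isButson_F9_iff h₁ h₂ h₃ h₄).1 hB, rfl⟩
    · rintro ⟨⟨x₁, x₂, x₃, x₄⟩, hx, rfl⟩
      have hn : ∀ z : ℂ, z ^ 6 = 1 → ‖z‖ = 1 :=
        fun z hz => Complex.norm_eq_one_of_pow_eq_one hz (by norm_num)
      have h₁ := hn _ hx.1
      have h₂ := hn _ hx.2.1
      have h₃ := hn _ hx.2.2.1
      have h₄ := hn _ hx.2.2.2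
      exact ⟨⟨x₁, x₂, x₃, x₄, h₁, h₂, h₃, h₄, rfl⟩, (isButson_F9_iff h₁ h₂ h₃ h₄).2 hx⟩
  rw [h, Set.ncard_image_of_injective _ fun x y => F9_injective, Set.ncard_coe_finset,
    Finset.card_product, Finset.card_product, Finset.card_product, hcard]
  norm_num

/-! ### Cyclic recurrences of length three. -/

/-- Sequences indexed by triangles `s` whose consecutive values are related by the factors `w s`. -/
def chainSpace {ι : Type*} (w : ι → Fin 3 → ℂ) : Submodule ℂ (ι → Fin 3 → ℂ) where
  carrier := {u | ∀ s t, u s (t + 1) = w s t * u s t}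
  zero_mem' := by intro s t; simp
  add_mem' := by
    intro u v hu hv s t
    simp only [Pi.add_apply, hu s t, hv s t, mul_add]
  smul_mem' := by
    intro c u hu s t
    simp only [Pi.smul_apply, smul_eq_mul, hu s t]
    ring

theorem mem_chainSpace {ι : Type*} {w : ι → Fin 3 → ℂ} {u : ι → Fin 3 → ℂ} :
    u ∈ chainSpace w ↔ ∀ s t, u s (t + 1) = w s t * u s t := Iff.rfl

/-- On each triangle `u s 0` determines the other two values. Going once around multiplies it by `w
s 0 * w s 1 * w s 2`, so it is free if this product is `1` and must vanish otherwise. -/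
theorem finrank_chainSpace {ι : Type*} [Fintype ι] (w : ι → Fin 3 → ℂ)
    [DecidablePred fun s => w s 0 * w s 1 * w s 2 = 1] :
    Module.finrank ℂ (chainSpace w) =
      (Finset.univ.filter fun s => w s 0 * w s 1 * w s 2 = 1).card := by
  let f : chainSpace w →ₗ[ℂ] ({s // w s 0 * w s 1 * w s 2 = 1} → ℂ) :=
    { toFun := fun u s => u.1 s.1 0
      map_add' := fun _ _ => rfl
      map_smul' := fun _ _ => rfl }
  have hf : Function.Bijective f := by
    constructor
    · rw [← LinearMap.ker_eq_bot, LinearMap.ker_eq_bot']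
      rintro ⟨u, hu⟩ h0
      have hu0 : ∀ s, u s 0 = 0 := by
        intro s
        by_cases hs : w s 0 * w s 1 * w s 2 = 1
        · exact congrFun h0 ⟨s, hs⟩
        · have h1 : u s 1 = w s 0 * u s 0 := hu s 0
          have h2 : u s 2 = w s 1 * u s 1 := hu s 1
          have h3 : u s 0 = w s 2 * u s 2 := hu s 2
          have h4 : (w s 0 * w s 1 * w s 2 - 1) * u s 0 = 0 := by
            linear_combination (-h3) - w s 2 * h2 - w s 2 * w s 1 * h1
          exact (mul_eq_zero.1 h4).resolve_left (sub_ne_zero.2 hs)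
      have hu1 : ∀ s, u s 1 = 0 := fun s => (hu s 0).trans (by rw [hu0, mul_zero])
      have hu2 : ∀ s, u s 2 = 0 := fun s => (hu s 1).trans (by rw [hu1, mul_zero])
      refine Subtype.ext (funext fun s => funext fun t => ?_)
      fin_cases t
      exacts [hu0 s, hu1 s, hu2 s]
    · intro z
      refine ⟨⟨fun s => if hs : w s 0 * w s 1 * w s 2 = 1 then
        ![z ⟨s, hs⟩, w s 0 * z ⟨s, hs⟩, w s 1 * (w s 0 * z ⟨s, hs⟩)] else 0, ?_⟩, ?_⟩
      · intro s t
        by_cases hs : w s 0 * w s 1 * w s 2 = 1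
        · simp only [hs, dif_pos]
          fin_cases t
          · rfl
          · rfl
          · change z ⟨s, hs⟩ = w s 2 * (w s 1 * (w s 0 * z ⟨s, hs⟩))
            linear_combination (-z ⟨s, hs⟩) * hs
        · simp [hs]
      · funext s
        change (if hs : w s 0 * w s 1 * w s 2 = 1 then
          ![z ⟨s, hs⟩, w s 0 * z ⟨s, hs⟩, w s 1 * (w s 0 * z ⟨s, hs⟩)] else 0) 0 = z s
        rw [dif_pos s.2]
        rfl
  rw [(LinearEquiv.ofBijective f hf).finrank_eq, Module.finrank_fintype_fun_eq_card,
    Fintype.card_subtype]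

/-! ### The linearized constraint of the Fourier family after a Fourier transform. -/

/-- The partial Fourier transform of a real matrix over block rows and positions of columns. -/
def hat (R : Matrix (Fin 3 × Fin 3) (Fin 3 × Fin 3) ℝ) (m n p c : Fin 3) : ℂ :=
  ∑ a, ∑ k, chi (a * m) * chi (n * k) * (R (a, p) (c, k) : ℂ)

theorem star_hat (R : Matrix (Fin 3 × Fin 3) (Fin 3 × Fin 3) ℝ) (m n p c : Fin 3) :
    star (hat R m n p c) = hat R (-m) (-n) p c := by
  simp only [hat, star_sum, star_mul', star_chi, Complex.star_def, Complex.conj_ofReal]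
  refine Finset.sum_congr rfl fun a _ => Finset.sum_congr rfl fun k _ => ?_
  congr 3
  · revert a m; decide
  · revert n k; decide

theorem eq_zero_of_hat_eq_zero {R : Matrix (Fin 3 × Fin 3) (Fin 3 × Fin 3) ℝ}
    (h : ∀ m n p c, hat R m n p c = 0) : R = 0 := by
  ext ⟨a, p⟩ ⟨c, k⟩
  have h1 : ∀ n, ∑ k, chi (n * k) * (R (a, p) (c, k) : ℂ) = 0 := by
    intro n
    refine eq_zero_of_sum_chi_eq_zero
      (f := fun a => ∑ k, chi (n * k) * (R (a, p) (c, k) : ℂ)) (fun m => ?_) a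
    rw [← h m n p c, hat]
    refine Finset.sum_congr rfl fun a _ => ?_
    rw [Finset.mul_sum]
    refine Finset.sum_congr rfl fun k _ => ?_
    rw [mul_comm m a, mul_assoc]
  have h2 := eq_zero_of_sum_chi_eq_zero (f := fun k => (R (a, p) (c, k) : ℂ)) h1 k
  exact Complex.ofReal_eq_zero.1 h2

/-- The linearized unitarity constraint of the Fourier family after a Fourier transform. -/
def HatRelated (x₁ x₂ x₃ x₄ : ℂ) (R : Matrix (Fin 3 × Fin 3) (Fin 3 × Fin 3) ℝ)
    (b c p q : Fin 3) : Prop :=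
  star (delta x₁ x₂ x₃ x₄ b p) * delta x₁ x₂ x₃ x₄ c p * hat R (c - b) (p - q) p c =
    star (delta x₁ x₂ x₃ x₄ b q) * delta x₁ x₂ x₃ x₄ c q * hat R (c - b) (p - q) q b

theorem HatRelated.symm {x₁ x₂ x₃ x₄ : ℂ} {R : Matrix (Fin 3 × Fin 3) (Fin 3 × Fin 3) ℝ}
    {b c p q : Fin 3} (h : HatRelated x₁ x₂ x₃ x₄ R b c p q) :
    HatRelated x₁ x₂ x₃ x₄ R c b q p := by
  have e1 : ∀ b c : Fin 3, -(c - b) = b - c := by decide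
  have h' := congrArg star h
  simp only [star_mul', star_star, star_hat, e1] at h'
  rw [HatRelated]
  linear_combination -h'

theorem sum_rotate (f : Fin 3 → Fin 3 → Fin 3 → Fin 3 → ℂ) :
    ∑ j, ∑ k, ∑ a, ∑ i, f j k a i = ∑ a, ∑ k, ∑ i, ∑ j, f j k a i := by
  calc ∑ j, ∑ k, ∑ a, ∑ i, f j k a i = ∑ k, ∑ j, ∑ a, ∑ i, f j k a i := Finset.sum_comm
    _ = ∑ k, ∑ a, ∑ j, ∑ i, f j k a i := Finset.sum_congr rfl fun _ _ => Finset.sum_comm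
    _ = ∑ a, ∑ k, ∑ j, ∑ i, f j k a i := Finset.sum_comm
    _ = ∑ a, ∑ k, ∑ i, ∑ j, f j k a i :=
      Finset.sum_congr rfl fun _ _ => Finset.sum_congr rfl fun _ _ => Finset.sum_comm

/-- Orthogonality of characters collapses the sum over `i`: summing over `j` forces `i = p` in the
term with `R (a, i) (c, k)`, and summing over `k` forces `i = q` in the other term. -/
theorem sum_fourier (g : Fin 3 → ℂ) (R : Matrix (Fin 3 × Fin 3) (Fin 3 × Fin 3) ℝ)
    (b c p q : Fin 3) :
    ∑ j, ∑ k, chi (p * j) * (star (chi (q * k)) * ∑ a, ∑ i,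
      chi (a * (c - b)) * g i * (star (chi (i * j)) * chi (i * k)) *
        ((R (a, i) (c, k) : ℂ) - R (a, i) (b, j))) =
      3 * (g p * hat R (c - b) (p - q) p c - g q * hat R (c - b) (p - q) q b) := by
  have h1 : ∑ j, ∑ k, chi (p * j) * (star (chi (q * k)) * ∑ a, ∑ i,
      chi (a * (c - b)) * g i * (star (chi (i * j)) * chi (i * k)) * (R (a, i) (c, k) : ℂ)) =
      3 * (g p * hat R (c - b) (p - q) p c) := by
    simp only [Finset.mul_sum, hat]
    rw [sum_rotate]
    refine Finset.sum_congr rfl fun a _ => Finset.sum_congr rfl fun k _ => ?_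
    have : ∀ i, ∑ j, chi (p * j) * (star (chi (q * k)) *
        (chi (a * (c - b)) * g i * (star (chi (i * j)) * chi (i * k)) * (R (a, i) (c, k) : ℂ))) =
        (if p = i then 3 else 0) * (star (chi (q * k)) * chi (a * (c - b)) * g i * chi (i * k) *
          (R (a, i) (c, k) : ℂ)) := by
      intro i
      rw [← sum_chi_mul_star_chi, Finset.sum_mul]
      refine Finset.sum_congr rfl fun j _ => ?_
      ring
    simp only [this, ite_mul, zero_mul, Finset.sum_ite_eq, Finset.mem_univ, if_true]
    rw [← chi_mul_star_chi]
    ring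
  have h2 : ∑ j, ∑ k, chi (p * j) * (star (chi (q * k)) * ∑ a, ∑ i,
      chi (a * (c - b)) * g i * (star (chi (i * j)) * chi (i * k)) * (R (a, i) (b, j) : ℂ)) =
      3 * (g q * hat R (c - b) (p - q) q b) := by
    rw [Finset.sum_comm]
    simp only [Finset.mul_sum, hat]
    rw [sum_rotate]
    refine Finset.sum_congr rfl fun a _ => Finset.sum_congr rfl fun j _ => ?_
    have : ∀ i, ∑ k, chi (p * j) * (star (chi (q * k)) *
        (chi (a * (c - b)) * g i * (star (chi (i * j)) * chi (i * k)) * (R (a, i) (b, j) : ℂ))) =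
        (if i = q then 3 else 0) * (chi (p * j) * chi (a * (c - b)) * g i * star (chi (i * j)) *
          (R (a, i) (b, j) : ℂ)) := by
      intro i
      rw [← sum_chi_mul_star_chi, Finset.sum_mul]
      refine Finset.sum_congr rfl fun k _ => ?_
      ring
    simp only [this, ite_mul, zero_mul, Finset.sum_ite_eq', Finset.mem_univ, if_true]
    rw [← chi_mul_star_chi]
    ring
  rw [mul_sub, ← h1, ← h2]
  simp only [mul_sub, Finset.sum_sub_distrib]

/-- The transform over the column positions `j` and `k` is invertible, so nothing is lost in passing
to the transformed equations. -/
theorem mem_phaseSpace_F9 {x₁ x₂ x₃ x₄ : ℂ} {R : Matrix (Fin 3 × Fin 3) (Fin 3 × Fin 3) ℝ} :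
    R ∈ phaseSpace (F9 x₁ x₂ x₃ x₄) ↔ ∀ b c p q, HatRelated x₁ x₂ x₃ x₄ R b c p q := by
  have key : ∀ b j c k, ∑ i, star (F9 x₁ x₂ x₃ x₄ i (b, j)) * F9 x₁ x₂ x₃ x₄ i (c, k) *
      ((R i (c, k) : ℂ) - (R i (b, j) : ℂ)) =
      ∑ a, ∑ i, chi (a * (c - b)) * (star (delta x₁ x₂ x₃ x₄ b i) * delta x₁ x₂ x₃ x₄ c i) *
        (star (chi (i * j)) * chi (i * k)) * ((R (a, i) (c, k) : ℂ) - R (a, i) (b, j)) := by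
    intro b j c k
    rw [Fintype.sum_prod_type]
    refine Finset.sum_congr rfl fun a _ => Finset.sum_congr rfl fun i _ => ?_
    rw [F9_apply, F9_apply, star_mul', star_mul', ← star_chi_mul_chi]
    ring
  have key2 := fun b c p q => sum_fourier
    (fun i => star (delta x₁ x₂ x₃ x₄ b i) * delta x₁ x₂ x₃ x₄ c i) R b c p q
  simp only [← key] at key2
  rw [mem_phaseSpace]
  constructor
  · intro h b c p q
    have h' := key2 b c p q
    simp only [h, mul_zero, Finset.sum_const_zero] at h'
    exact sub_eq_zero.1 ((mul_eq_zero.1 h'.symm).resolve_left (by norm_num))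
  · rintro h ⟨b, j⟩ ⟨c, k⟩
    have h1 : ∀ p q, ∑ j, ∑ k, chi (p * j) * (star (chi (q * k)) *
        ∑ i, star (F9 x₁ x₂ x₃ x₄ i (b, j)) * F9 x₁ x₂ x₃ x₄ i (c, k) *
          ((R i (c, k) : ℂ) - (R i (b, j) : ℂ))) = 0 := by
      intro p q
      rw [key2, sub_eq_zero.2 (h b c p q), mul_zero]
    simp only [← Finset.mul_sum] at h1
    refine eq_zero_of_sum_star_chi_eq_zero (f := fun k =>
      ∑ i, star (F9 x₁ x₂ x₃ x₄ i (b, j)) * F9 x₁ x₂ x₃ x₄ i (c, k) *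
          ((R i (c, k) : ℂ) - (R i (b, j) : ℂ))) (fun q => ?_) k
    exact eq_zero_of_sum_chi_eq_zero (f := fun j => ∑ k, star (chi (q * k)) *
        ∑ i, star (F9 x₁ x₂ x₃ x₄ i (b, j)) * F9 x₁ x₂ x₃ x₄ i (c, k) *
          ((R i (c, k) : ℂ) - (R i (b, j) : ℂ))) (fun p => h1 p q) j

/-! ### Decoupling along the lines of the affine plane over `ℤ/3`. -/

/-- A representative `(m, n)` of each pair of opposite nonzero frequencies. -/
def freq : Option (Fin 3) → Fin 3 × Fin 3
  | none => (0, 1)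
  | some n => (1, n)

/-- The points `(p, c)` on the lines in the direction of a frequency. -/
def linePoint : Option (Fin 3) → Fin 3 → Fin 3 → Fin 3 × Fin 3
  | none, s, t => (t, s)
  | some n, s, t => (s + n * t, t)

theorem linePoint_succ (o : Option (Fin 3)) (s t : Fin 3) :
    (linePoint o s (t + 1)).2 - (linePoint o s t).2 = (freq o).1 ∧
      (linePoint o s (t + 1)).1 - (linePoint o s t).1 = (freq o).2 := by
  revert o s t
  decide

theorem exists_linePoint_eq (o : Option (Fin 3)) (p c : Fin 3) :
    ∃ s t, linePoint o s t = (p, c) := by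
  revert o p c
  decide

theorem exists_linePoint (b c p q : Fin 3) : (b = c ∧ p = q) ∨
    (∃ o s t, linePoint o s t = (q, b) ∧ linePoint o s (t + 1) = (p, c)) ∨
    ∃ o s t, linePoint o s t = (p, c) ∧ linePoint o s (t + 1) = (q, b) := by
  revert b c p q
  decide +kernel

theorem exists_freq (m n : Fin 3) : (m = 0 ∧ n = 0) ∨ ∃ o, freq o = (m, n) ∨ freq o = (-m, -n) := by
  revert m n
  decide

/-- The Fourier coordinates of a real matrix, along lines. -/
def lineCoord : Matrix (Fin 3 × Fin 3) (Fin 3 × Fin 3) ℝ →ₗ[ℝ]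
    (Fin 3 × Fin 3 → ℝ) × (Option (Fin 3) × Fin 3 → Fin 3 → ℂ) where
  toFun R := (fun x => ∑ a, ∑ k, R (a, x.1) (x.2, k), fun o t =>
    hat R (freq o.1).1 (freq o.1).2 (linePoint o.1 o.2 t).1 (linePoint o.1 o.2 t).2)
  map_add' R S := by
    refine Prod.ext (funext fun x => ?_) (funext fun o => funext fun t => ?_)
    · simp [Finset.sum_add_distrib]
    · simp [hat, mul_add, Finset.sum_add_distrib]
  map_smul' r R := by
    refine Prod.ext (funext fun x => ?_) (funext fun o => funext fun t => ?_)
    · simp [Finset.mul_sum]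
    · simp [hat, Finset.mul_sum, mul_left_comm]

theorem lineCoord_snd (R : Matrix (Fin 3 × Fin 3) (Fin 3 × Fin 3) ℝ) (o : Option (Fin 3))
    (s t : Fin 3) : (lineCoord R).2 (o, s) t =
      hat R (freq o).1 (freq o).2 (linePoint o s t).1 (linePoint o s t).2 := rfl

/-- For real `R`, opposite frequencies are conjugate (`star_hat`), so one representative of each
pair, together with the zero frequency, determines the whole transform. -/
theorem lineCoord_injective : Function.Injective lineCoord := by
  rw [← LinearMap.ker_eq_bot, LinearMap.ker_eq_bot']
  intro R hR
  have key : ∀ o p c, hat R (freq o).1 (freq o).2 p c = 0 := by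
    intro o p c
    obtain ⟨s, t, h⟩ := exists_linePoint_eq o p c
    have := lineCoord_snd R o s t
    rw [hR, h] at this
    exact this.symm
  refine eq_zero_of_hat_eq_zero fun m n p c => ?_
  rcases exists_freq m n with ⟨rfl, rfl⟩ | ⟨o, h | h⟩
  · have h0 : ∑ a, ∑ k, R (a, p) (c, k) = 0 := congrFun (congrArg Prod.fst hR) (p, c)
    have h1 := congrArg (fun r : ℝ => (r : ℂ)) h0
    simpa [hat, chi_zero] using h1
  · have := key o p c
    rwa [h] at this
  · have := key o p c
    rw [h, ← star_hat, star_eq_zero] at this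
    exact this

/-- The Fourier coordinates of a real matrix, along lines, as an isomorphism. -/
def lineEquiv : Matrix (Fin 3 × Fin 3) (Fin 3 × Fin 3) ℝ ≃ₗ[ℝ]
    (Fin 3 × Fin 3 → ℝ) × (Option (Fin 3) × Fin 3 → Fin 3 → ℂ) :=
  LinearEquiv.ofInjectiveOfFinrankEq lineCoord lineCoord_injective (by
    -- Both sides have real dimension `81 = 9 + 2 * 12 * 3`.
    rw [Module.finrank_matrix, Module.finrank_prod, Module.finrank_fintype_fun_eq_card,
      Module.finrank_pi_fintype]
    simp [Module.finrank_pi_fintype])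

/-- The factors which relate consecutive Fourier coordinates on a line. -/
def lineFactor (x₁ x₂ x₃ x₄ : ℂ) (o : Option (Fin 3) × Fin 3) (t : Fin 3) : ℂ :=
  delta x₁ x₂ x₃ x₄ (linePoint o.1 o.2 t).2 (linePoint o.1 o.2 (t + 1)).1 *
    delta x₁ x₂ x₃ x₄ (linePoint o.1 o.2 (t + 1)).2 (linePoint o.1 o.2 t).1 /
  (delta x₁ x₂ x₃ x₄ (linePoint o.1 o.2 t).2 (linePoint o.1 o.2 t).1 *
    delta x₁ x₂ x₃ x₄ (linePoint o.1 o.2 (t + 1)).2 (linePoint o.1 o.2 (t + 1)).1)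

/-- The relation at frequency `(m, n)` links only points `(p, c)` differing by `(n, m)`, which are
consecutive on a line in that direction. Pairs met in the opposite order follow by conjugation, and
equal points give a trivial equation, so the nine zero-frequency coordinates stay free. -/
theorem mem_phaseSpace_F9_iff_lineCoord {x₁ x₂ x₃ x₄ : ℂ} (h₁ : ‖x₁‖ = 1) (h₂ : ‖x₂‖ = 1)
    (h₃ : ‖x₃‖ = 1) (h₄ : ‖x₄‖ = 1) {R : Matrix (Fin 3 × Fin 3) (Fin 3 × Fin 3) ℝ} :
    R ∈ phaseSpace (F9 x₁ x₂ x₃ x₄) ↔ (lineCoord R).2 ∈ chainSpace (lineFactor x₁ x₂ x₃ x₄) := by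
  have hd := norm_delta h₁ h₂ h₃ h₄
  have hd0 : ∀ b i, delta x₁ x₂ x₃ x₄ b i ≠ 0 := fun b i => norm_ne_zero_iff.1 (by simp [hd])
  have hs : ∀ b i, star (delta x₁ x₂ x₃ x₄ b i) = (delta x₁ x₂ x₃ x₄ b i)⁻¹ :=
    fun b i => star_eq_inv (hd b i)
  have key : ∀ o s t, HatRelated x₁ x₂ x₃ x₄ R (linePoint o s t).2 (linePoint o s (t + 1)).2
      (linePoint o s (t + 1)).1 (linePoint o s t).1 ↔
      (lineCoord R).2 (o, s) (t + 1) =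
        lineFactor x₁ x₂ x₃ x₄ (o, s) t * (lineCoord R).2 (o, s) t := by
    intro o s t
    obtain ⟨e1, e2⟩ := linePoint_succ o s t
    rw [HatRelated, e1, e2, lineCoord_snd, lineCoord_snd, lineFactor, hs, hs]
    have a1 := hd0 (linePoint o s t).2 (linePoint o s t).1
    have a2 := hd0 (linePoint o s t).2 (linePoint o s (t + 1)).1
    have a3 := hd0 (linePoint o s (t + 1)).2 (linePoint o s t).1
    have a4 := hd0 (linePoint o s (t + 1)).2 (linePoint o s (t + 1)).1
    field_simp
  rw [mem_phaseSpace_F9, mem_chainSpace]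
  constructor
  · rintro h ⟨o, s⟩ t
    exact (key o s t).1 (h _ _ _ _)
  · intro h b c p q
    rcases exists_linePoint b c p q with ⟨rfl, rfl⟩ | ⟨o, s, t, e1, e2⟩ | ⟨o, s, t, e1, e2⟩
    · rfl
    · have := (key o s t).2 (h _ _)
      rwa [e1, e2] at this
    · have := (key o s t).2 (h _ _)
      rw [e1, e2] at this
      exact this.symm

theorem finrank_phaseSpace_F9 {x₁ x₂ x₃ x₄ : ℂ} (h₁ : ‖x₁‖ = 1) (h₂ : ‖x₂‖ = 1)
    (h₃ : ‖x₃‖ = 1) (h₄ : ‖x₄‖ = 1) :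
    Module.finrank ℝ (phaseSpace (F9 x₁ x₂ x₃ x₄)) =
      9 + 2 * Module.finrank ℂ (chainSpace (lineFactor x₁ x₂ x₃ x₄)) := by
  have hm := fun R => mem_phaseSpace_F9_iff_lineCoord h₁ h₂ h₃ h₄ (R := R)
  have ha : ∀ R, lineEquiv R = lineCoord R := fun R => rfl
  let e : phaseSpace (F9 x₁ x₂ x₃ x₄) ≃ₗ[ℝ]
      (Fin 3 × Fin 3 → ℝ) × chainSpace (lineFactor x₁ x₂ x₃ x₄) :=
    { toFun := fun R => ((lineEquiv R.1).1, ⟨(lineEquiv R.1).2, (hm _).1 R.2⟩)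
      map_add' := fun R S => by
        refine Prod.ext ?_ (Subtype.ext ?_)
        · simp
        · simp
      map_smul' := fun r R => by
        refine Prod.ext ?_ (Subtype.ext ?_)
        · simp
        · simp
      invFun := fun y => ⟨lineEquiv.symm (y.1, y.2.1), (hm _).2 (by
        rw [← ha, LinearEquiv.apply_symm_apply]
        exact y.2.2)⟩
      left_inv := fun R => Subtype.ext (by simp)
      right_inv := fun y => by
        refine Prod.ext ?_ (Subtype.ext ?_)
        · simp
        · simp }
  rw [e.finrank_eq, Module.finrank_prod, Module.finrank_fintype_fun_eq_card,
    finrank_real_of_complex]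
  simp

/-! ### Holonomies, and why nine trivial lines cannot occur. -/

/-- The product of the three factors along a line. -/
def lineHolonomy (x₁ x₂ x₃ x₄ : ℂ) (o : Option (Fin 3)) (s : Fin 3) : ℂ :=
  lineFactor x₁ x₂ x₃ x₄ (o, s) 0 * lineFactor x₁ x₂ x₃ x₄ (o, s) 1 *
    lineFactor x₁ x₂ x₃ x₄ (o, s) 2

variable {x₁ x₂ x₃ x₄ : ℂ}

theorem lineHolonomy_none (hd : ∀ b i, delta x₁ x₂ x₃ x₄ b i ≠ 0) (s : Fin 3) :
    lineHolonomy x₁ x₂ x₃ x₄ none s = 1 := by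
  simp only [lineHolonomy, lineFactor, linePoint, mul_comm (delta x₁ x₂ x₃ x₄ s (_ + 1))]
  rw [div_self, div_self, div_self, one_mul, one_mul] <;> simp [hd]

theorem lineHolonomy_zero (hd : ∀ b i, delta x₁ x₂ x₃ x₄ b i ≠ 0) (s : Fin 3) :
    lineHolonomy x₁ x₂ x₃ x₄ (some 0) s = 1 := by
  simp only [lineHolonomy, lineFactor, linePoint, zero_mul, add_zero]
  rw [div_self, div_self, div_self, one_mul, one_mul] <;> simp [hd]

/-- Meant for a line that meets each row and column of the array `delta` once: `p` is the product of
the three phases on it and `q` that of the six others. The holonomy has each phase on the line twice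
in its denominator and each other phase once in its numerator. -/
theorem eq_one_iff_eq_pow_three {h p q x : ℂ} (hp : p ≠ 0) (hh : h = q / p ^ 2)
    (hx : x = p * q) : h = 1 ↔ x = p ^ 3 := by
  rw [hh, hx, div_eq_one_iff_eq (pow_ne_zero 2 hp), pow_succ' p 2, mul_right_inj' hp]

theorem lineHolonomy_one (h₁ : x₁ ≠ 0) (h₂ : x₂ ≠ 0) (h₃ : x₃ ≠ 0) (h₄ : x₄ ≠ 0) (s : Fin 3) :
    lineHolonomy x₁ x₂ x₃ x₄ (some 1) s = 1 ↔
      x₁ * x₂ * x₃ * x₄ = ![x₁ * x₄, x₂, x₃] s ^ 3 := by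
  fin_cases s
  · refine eq_one_iff_eq_pow_three (mul_ne_zero h₁ h₄) (p := x₁ * x₄)
      (q := x₂ * x₃) ?_ (by ring)
    change 1 * 1 / (1 * x₁) * (x₂ * x₃ / (x₁ * x₄)) *
      (1 * 1 / (x₄ * 1)) = _
    field_simp
  · refine eq_one_iff_eq_pow_three h₂ (p := x₂)
      (q := x₁ * x₃ * x₄) ?_ (by ring)
    change 1 * x₁ / (1 * x₂) * (1 * x₄ / (x₂ * 1)) *
      (x₃ * 1 / (1 * 1)) = _
    field_simp
  · refine eq_one_iff_eq_pow_three h₃ (p := x₃)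
      (q := x₁ * x₂ * x₄) ?_ (by ring)
    change 1 * x₂ / (1 * 1) * (x₁ * 1 / (1 * x₃)) *
      (x₄ * 1 / (x₃ * 1)) = _
    field_simp

theorem lineHolonomy_two (h₁ : x₁ ≠ 0) (h₂ : x₂ ≠ 0) (h₃ : x₃ ≠ 0) (h₄ : x₄ ≠ 0) (s : Fin 3) :
    lineHolonomy x₁ x₂ x₃ x₄ (some 2) s = 1 ↔
      x₁ * x₂ * x₃ * x₄ = ![x₂ * x₃, x₄, x₁] s ^ 3 := by
  fin_cases s
  · refine eq_one_iff_eq_pow_three (mul_ne_zero h₂ h₃) (p := x₂ * x₃)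
      (q := x₁ * x₄) ?_ (by ring)
    change 1 * 1 / (1 * x₂) * (x₁ * x₄ / (x₂ * x₃)) *
      (1 * 1 / (x₃ * 1)) = _
    field_simp
  · refine eq_one_iff_eq_pow_three h₄ (p := x₄)
      (q := x₁ * x₂ * x₃) ?_ (by ring)
    change 1 * x₁ / (1 * 1) * (x₂ * 1 / (1 * x₄)) *
      (x₃ * 1 / (x₄ * 1)) = _
    field_simp
  · refine eq_one_iff_eq_pow_three h₁ (p := x₁)
      (q := x₂ * x₃ * x₄) ?_ (by ring)
    change 1 * x₂ / (1 * x₁) * (1 * x₃ / (x₁ * 1)) *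
      (x₄ * 1 / (1 * 1)) = _
    field_simp

/-- As `p ^ 3` is `1` or `-1`, it is its own cube. This separates a condition `x = y` common to all
six lines from an equation between signs. -/
theorem eq_pow_three_iff {x p y : ℂ} (hp : p ^ 6 = 1) (hx : x ^ 3 = y) :
    x = p ^ 3 ↔ x = y ∧ y = p ^ 3 := by
  constructor
  · intro h
    have : y = p ^ 3 := by
      rw [← hx, h]
      linear_combination (p ^ 3) * hp
    exact ⟨h.trans this.symm, this⟩
  · rintro ⟨h, h'⟩
    exact h.trans h'

theorem finrank_chainSpace_lineFactor_ne (e₁ : x₁ ^ 6 = 1) (e₂ : x₂ ^ 6 = 1) (e₃ : x₃ ^ 6 = 1)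
    (e₄ : x₄ ^ 6 = 1) : Module.finrank ℂ (chainSpace (lineFactor x₁ x₂ x₃ x₄)) ≠ 9 := by
  classical
  have h0 : ∀ z : ℂ, z ^ 6 = 1 → z ≠ 0 := by
    rintro _ h rfl
    norm_num at h
  have h1 := h0 _ e₁
  have h2 := h0 _ e₂
  have h3 := h0 _ e₃
  have h4 := h0 _ e₄
  have hd : ∀ b i, delta x₁ x₂ x₃ x₄ b i ≠ 0 := by
    intro b i
    fin_cases b <;> fin_cases i <;> simp [delta, *]
  have e14 : (x₁ * x₄) ^ 6 = 1 := by rw [mul_pow, e₁, e₄, one_mul]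
  have e23 : (x₂ * x₃) ^ 6 = 1 := by rw [mul_pow, e₂, e₃, one_mul]
  have hs : ∀ z : ℂ, z ^ 6 = 1 → z ^ 3 = 1 ∨ z ^ 3 = -1 := by
    intro z hz
    rw [← sq_eq_one_iff, ← pow_mul, hz]
  have hX : (x₁ * x₂ * x₃ * x₄) ^ 3 = x₁ ^ 3 * x₂ ^ 3 * x₃ ^ 3 * x₄ ^ 3 := by ring
  have hne : (-1 : ℂ) ≠ 1 := by norm_num
  have hol : ∀ o s, lineFactor x₁ x₂ x₃ x₄ (o, s) 0 * lineFactor x₁ x₂ x₃ x₄ (o, s) 1 *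
    lineFactor x₁ x₂ x₃ x₄ (o, s) 2 = lineHolonomy x₁ x₂ x₃ x₄ o s := fun _ _ => rfl
  rw [finrank_chainSpace, Finset.card_filter]
  simp only [Fintype.sum_prod_type, Fintype.sum_option, Fin.sum_univ_three, hol]
  simp only [lineHolonomy_none hd, lineHolonomy_zero hd, lineHolonomy_one h1 h2 h3 h4,
    lineHolonomy_two h1 h2 h3 h4, Matrix.cons_val]
  simp only [eq_pow_three_iff e14 hX, eq_pow_three_iff e₂ hX, eq_pow_three_iff e₃ hX,
    eq_pow_three_iff e23 hX, eq_pow_three_iff e₄ hX, eq_pow_three_iff e₁ hX]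
  simp only [mul_pow]
  by_cases hY : x₁ * x₂ * x₃ * x₄ = x₁ ^ 3 * x₂ ^ 3 * x₃ ^ 3 * x₄ ^ 3
  · simp only [hY, true_and]
    -- The product of the six signs on the right is a square, hence `1`, so an even number of the
    -- six equations holds. All sixteen choices of signs are checked, and exactly three trivial
    -- lines besides the six axis-parallel ones never occur.
    rcases hs _ e₁ with a₁ | a₁ <;> rcases hs _ e₂ with a₂ | a₂ <;>
      rcases hs _ e₃ with a₃ | a₃ <;> rcases hs _ e₄ with a₄ | a₄ <;>
      simp [a₁, a₂, a₃, a₄, hne, hne.symm]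
  · simp [hY]

theorem defect_F9_ne (h₁ : ‖x₁‖ = 1) (h₂ : ‖x₂‖ = 1) (h₃ : ‖x₃‖ = 1) (h₄ : ‖x₄‖ = 1)
    (h : IsButson 6 (F9 x₁ x₂ x₃ x₄)) : defect (F9 x₁ x₂ x₃ x₄) ≠ 10 := by
  obtain ⟨e₁, e₂, e₃, e₄⟩ := (isButson_F9_iff h₁ h₂ h₃ h₄).1 h
  have hr := finrank_phaseSpace_F9 h₁ h₂ h₃ h₄
  have hn := finrank_chainSpace_lineFactor_ne e₁ e₂ e₃ e₄
  simp only [defect, Fintype.card_prod, Fintype.card_fin]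
  -- The defect is `9 + 2L - 17`, which equals `10` only for `L = 9`.
  omega

end BCCB

end

theorem mainTheorem3 :
    (BCCB.IsButson 6 BCCB.BC9Ab ∧ BCCB.IsButson 6 BCCB.BC9Abᴴ) ∧
    (BCCB.BC9Ab ∈ BCCB.BC9Orbit ∧ BCCB.BC9Abᴴ ∈ BCCB.BC9Orbit) ∧
    (BCCB.defect BCCB.BC9Ab = 10 ∧ BCCB.defect BCCB.BC9Abᴴ = 10) ∧
    ¬ BCCB.Equivalent BCCB.BC9Ab BCCB.BC9Abᴴ ∧
    (∀ K ∈ BCCB.F9Orbit,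
      ¬ BCCB.Equivalent BCCB.BC9Ab K ∧ ¬ BCCB.Equivalent BCCB.BC9Abᴴ K) ∧
    {K ∈ BCCB.F9Orbit | BCCB.IsButson 6 K}.ncard = 6 ^ 4 ∧
    (∀ K ∈ BCCB.F9Orbit, BCCB.IsButson 6 K → BCCB.defect K ≠ 10) := by
  refine ⟨⟨BCCB.isButson_BC9Ab, BCCB.isButson_BC9Ab_conjTranspose⟩,
    ⟨BCCB.BC9Ab_mem_orbit, BCCB.conjTranspose_mem_BC9Orbit BCCB.BC9Ab_mem_orbit⟩,
    ⟨BCCB.defect_BC9Ab, BCCB.defect_BC9Ab_conjTranspose⟩,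
    BCCB.not_equivalent_BC9Ab_conjTranspose, ?_, BCCB.ncard_F9Orbit_isButson, ?_⟩
  · rintro _ ⟨x₁, x₂, x₃, x₄, -, -, -, -, rfl⟩
    have h := BCCB.hasParallelTriples_F9 x₁ x₂ x₃ x₄
    exact ⟨fun e => BCCB.not_hasParallelTriples_BC9Ab (e.hasParallelTriples h),
      fun e => BCCB.not_hasParallelTriples_BC9Ab_conjTranspose (e.hasParallelTriples h)⟩
  · rintro _ ⟨x₁, x₂, x₃, x₄, h₁, h₂, h₃, h₄, rfl⟩ h
    exact BCCB.defect_F9_ne h₁ h₂ h₃ h₄ h
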